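/- Let $C=\{\mathsf T,\mathsf F,\mathsf U\}$ be the three-element algebra with negation $\neg\mathsf T=\mathsf F$, $\neg\mathsf F=\mathsf T$, $\neg\mathsf U=\mathsf U$, conjunction $\mathsf T\wedge y=y$, $\mathsf F\wedge y=\mathsf F$, $\mathsf U\wedge y=\mathsf U$, and disjunction $\mathsf T\vee y=\mathsf T$, $\mathsf F\vee y=y$, $\mathsf U\vee y=\mathsf U$ (McCarthy's sequential, i.e. short-circuit, connectives). For $S\subseteq\{\mathsf T,\mathsf F,\mathsf U\}$, conditional logic with the elements of $S$ distinguished is the equational logic over the signature with $\neg,\wedge,\vee$ and a constant symbol for each element of $S$ that has Guzmán and Squier's axioms \[ \begin{aligned} &\neg\neg x=x,\qquad \neg(x\wedge y)=\neg x\vee\neg y,\qquad (x\wedge y)\wedge z=x\wedge(y\wedge z),\qquad x\wedge(y\vee z)=(x\wedge y)\vee(x\wedge z),\\ &(x\vee y)\wedge z=(x\wedge z)\vee(\neg x\wedge y\wedge z),\qquad x\vee(x\wedge y)=x,\qquad (x\wedge y)\vee(y\wedge x)=(y\wedge x)\vee(x\wedge y), \end{aligned} \] together with $\neg\mathsf U=\mathsf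 U$ if $\mathsf U\in S$, and with $\mathsf T\wedge x=x$ and $\neg\mathsf T=\mathsf F$ if $\mathsf T,\mathsf F\in S$. A set $E$ of equations over this signature completely axiomatises conditional logic with $S$ distinguished if, for all open terms $s,t$ over any set of variables, the following are equivalent: $s=t$ is derivable from $E$ in equational logic; $s=t$ is derivable from the axioms just listed; $s=t$ is valid in $C$ (for all valuations of the variables, the constants denoting themselves). The set $E$ is independent if no $e\in E$ is derivable from $E\setminus\{e\}$. Consider the equations \[ \begin{aligned} &\text{(Neg)}\ \ \mathsf F=\neg\mathsf T, &&\text{(Or)}\ \ x\vee y=\neg(\neg x\wedge\neg y), &&\text{(Tand)}\ \ \mathsf T\wedge x=x,\\ &\text{(Abs)}\ \ x\wedge(x\vee y)=x, &&\text{(Mem)}\ \ (x\vee y)\wedge z=(\neg x\wedge(y\wedge z))\vee(x\wedge z),\\ &\text{(Com)}\ \ (x\wedge y)\vee(y\wedge x)=(y\wedge x)\vee(x\wedge y), &&\text{(Und)}\ \ \neg\mathsf U=\mathsf U. \end{aligned} \] (i) Conditional logic with no constants distinguished is completely axiomatised by the five axioms $\neg\neg x=x$, (Or), (Abs), (Mem),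 (Com), and these axioms are independent. (ii) Conditional logic with $\mathsf T$ and $\mathsf F$ distinguished is completely axiomatised by the six axioms (Neg), (Or), (Tand), (Abs), (Mem), (Com), and these axioms are independent. (iii) Conditional logic with only $\mathsf U$ distinguished is completely axiomatised by the six axioms $\neg\neg x=x$, (Und), (Or), (Abs), (Mem), (Com), and these axioms are independent. (iv) Conditional logic with $\mathsf T$, $\mathsf F$ and $\mathsf U$ distinguished is completely axiomatised by the seven axioms (Neg), (Or), (Tand), (Abs), (Mem), (Com), (Und), and these axioms are independent. -/

import Mathlib

universe u

namespace CondLogic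

/-- The three truth values: the carrier of the three-element algebra `C`. -/
inductive TV : Type
  | T
  | F
  | U
  deriving DecidableEq

namespace TV

/-- Negation on `C`. -/
def neg : TV → TV
  | T => F
  | F => T
  | U => U

/-- Short-circuit conjunction on `C`. -/
def and : TV → TV → TV
  | T, y => y
  | F, _ => F
  | U, _ => U

/-- Short-circuit disjunction on `C`. -/
def or : TV → TV → TV
  | T, _ => T
  | F, y => y
  | U, _ => U

end TV

/-- Open terms over the connectives `¬`, `∧`, `∨` and a constant symbol for each element of the
set `S` of distinguished truth values, with variables in `X`. -/
inductive Term (S : Set TV) (X : Type u) : Type u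
  | var (x : X) : Term S X
  | const (c : S) : Term S X
  | neg (t : Term S X) : Term S X
  | and (s t : Term S X) : Term S X
  | or (s t : Term S X) : Term S X

namespace Term

/-- Simultaneous substitution of terms for variables. -/
def subst {S : Set TV} {X : Type} {Y : Type u} (σ : X → Term S Y) : Term S X → Term S Y
  | var x => σ x
  | const c => const c
  | neg t => neg (subst σ t)
  | and s t => and (subst σ s) (subst σ t)
  | or s t => or (subst σ s) (subst σ t)

/-- The value of a term in `C` under a valuation of its variables; the constant symbol of a
distinguished truth value denotes that truth value. -/
def eval {S : Set TV} {X : Type u} (v : X → TV) : Term S X → TV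
  | var x => v x
  | const c => c
  | neg t => (eval v t).neg
  | and s t => (eval v s).and (eval v t)
  | or s t => (eval v s).or (eval v t)

end Term

/-- Equations between open terms, over a fixed countably infinite set of variables. -/
structure Equation (S : Set TV) : Type where
  lhs : Term S ℕ
  rhs : Term S ℕ

/-- `Derivable E s t`: the equation `s = t` is derivable from the equations in `E` in equational
logic (substitution instances of the equations in `E`, reflexivity, symmetry, transitivity,
congruence). -/
inductive Derivable {S : Set TV} (E : Set (Equation S)) {X : Type u} :
    Term S X → Term S X → Prop
  | ax (e : Equation S) (he : e ∈ E) (σ : ℕ → Term S X) :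
      Derivable E (e.lhs.subst σ) (e.rhs.subst σ)
  | refl (t : Term S X) : Derivable E t t
  | symm {s t : Term S X} : Derivable E s t → Derivable E t s
  | trans {r s t : Term S X} : Derivable E r s → Derivable E s t → Derivable E r t
  | neg {s t : Term S X} : Derivable E s t → Derivable E s.neg t.neg
  | and {s s' t t' : Term S X} :
      Derivable E s s' → Derivable E t t' → Derivable E (s.and t) (s'.and t')
  | or {s s' t t' : Term S X} :
      Derivable E s s' → Derivable E t t' → Derivable E (s.or t) (s'.or t')

/-- The equation `s = t` is valid in `C`. -/
def Valid {S : Set TV} {X : Type u} (s t : Term S X) : Prop :=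
  ∀ v : X → TV, s.eval v = t.eval v

section Axioms

variable {S : Set TV}

/-- The variable `x` of the axioms. -/
def x : Term S ℕ := .var 0

/-- The variable `y` of the axioms. -/
def y : Term S ℕ := .var 1

/-- The variable `z` of the axioms. -/
def z : Term S ℕ := .var 2

/-- `¬¬x = x` -/
def dnegAx : Equation S := ⟨x.neg.neg, x⟩

/-- `¬(x ∧ y) = ¬x ∨ ¬y` -/
def deMorganAx : Equation S := ⟨(x.and y).neg, x.neg.or y.neg⟩

/-- `(x ∧ y) ∧ z = x ∧ (y ∧ z)` -/
def assocAx : Equation S := ⟨(x.and y).and z, x.and (y.and z)⟩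

/-- `x ∧ (y ∨ z) = (x ∧ y) ∨ (x ∧ z)` -/
def distribAx : Equation S := ⟨x.and (y.or z), (x.and y).or (x.and z)⟩

/-- `(x ∨ y) ∧ z = (x ∧ z) ∨ (¬x ∧ y ∧ z)`; the bracketing of the last conjunction is immaterial
in the presence of `assocAx`. -/
def condAx : Equation S := ⟨(x.or y).and z, (x.and z).or (x.neg.and (y.and z))⟩

/-- `x ∨ (x ∧ y) = x` -/
def dualAbsAx : Equation S := ⟨x.or (x.and y), x⟩

/-- Com: `(x ∧ y) ∨ (y ∧ x) = (y ∧ x) ∨ (x ∧ y)` -/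
def comAx : Equation S := ⟨(x.and y).or (y.and x), (y.and x).or (x.and y)⟩

/-- Or: `x ∨ y = ¬(¬x ∧ ¬y)` -/
def orAx : Equation S := ⟨x.or y, (x.neg.and y.neg).neg⟩

/-- Abs: `x ∧ (x ∨ y) = x` -/
def absAx : Equation S := ⟨x.and (x.or y), x⟩

/-- Mem: `(x ∨ y) ∧ z = (¬x ∧ (y ∧ z)) ∨ (x ∧ z)` -/
def memAx : Equation S := ⟨(x.or y).and z, (x.neg.and (y.and z)).or (x.and z)⟩

/-- Und: `¬U = U` -/
def undAx (hU : TV.U ∈ S) : Equation S := ⟨(Term.const ⟨TV.U, hU⟩).neg, .const ⟨TV.U, hU⟩⟩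

/-- Tand: `T ∧ x = x` -/
def tandAx (hT : TV.T ∈ S) : Equation S := ⟨(Term.const ⟨TV.T, hT⟩).and x, x⟩

/-- `¬T = F` -/
def negTAx (hT : TV.T ∈ S) (hF : TV.F ∈ S) : Equation S :=
  ⟨(Term.const ⟨TV.T, hT⟩).neg, .const ⟨TV.F, hF⟩⟩

/-- Neg: `F = ¬T` -/
def negAx (hT : TV.T ∈ S) (hF : TV.F ∈ S) : Equation S :=
  ⟨.const ⟨TV.F, hF⟩, (Term.const ⟨TV.T, hT⟩).neg⟩

/-- The axioms of Guzmán and Squier for conditional logic with the elements of `S` distinguished: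
seven axioms without constants, `¬U = U` if `U` is distinguished, `T ∧ x = x` and `¬T = F` if `T`
and `F` are distinguished. -/
def gsAxioms (S : Set TV) : Set (Equation S) :=
  {dnegAx, deMorganAx, assocAx, distribAx, condAx, dualAbsAx, comAx}
    ∪ {e | ∃ hU : TV.U ∈ S, e = undAx hU}
    ∪ {e | ∃ (hT : TV.T ∈ S) (hF : TV.F ∈ S), e = tandAx hT ∨ e = negTAx hT hF}

end Axioms

/-- The axioms for conditional logic with no constants distinguished. -/
def eqCLNone : Set (Equation ∅) :=
  {dnegAx, orAx, absAx, memAx, comAx}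

/-- The axioms EqCL for conditional logic with `T` and `F` distinguished. -/
def eqCL : Set (Equation {TV.T, TV.F}) :=
  {negAx (by simp) (by simp), orAx, tandAx (by simp), absAx, memAx, comAx}

/-- The axioms for conditional logic with only `U` distinguished. -/
def eqCLOnlyU : Set (Equation {TV.U}) :=
  {dnegAx, undAx (by simp), orAx, absAx, memAx, comAx}

/-- The axioms EqCL^U for conditional logic with `T`, `F` and `U` distinguished. -/
def eqCLU : Set (Equation {TV.T, TV.F, TV.U}) :=
  {negAx (by simp) (by simp), orAx, tandAx (by simp), absAx, memAx, comAx, undAx (by simp)}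

/-- `E` completely axiomatises conditional logic with the elements of `S` distinguished: the
equations derivable from `E` are exactly those valid in the algebra `C`, and exactly those
derivable from the axioms of Guzmán and Squier. -/
def CompletelyAxiomatisesCL {S : Set TV} (E : Set (Equation S)) : Prop :=
  ∀ (X : Type u) (s t : Term S X),
    (Derivable E s t ↔ Valid s t) ∧ (Derivable E s t ↔ Derivable (gsAxioms S) s t)

/-- No equation in `E` is derivable from the others. -/
def Independent {S : Set TV} (E : Set (Equation S)) : Prop :=
  ∀ e ∈ E, ¬ Derivable (E \ {e}) e.lhs e.rhs

end CondLogic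

/-! Soundness is a finite check in `C`. For completeness it suffices that every model of `E`
satisfies every valid equation: applied to the free algebra of `E`, this turns validity into
derivability. The same holds for the axioms of Guzmán and Squier, so the two derivability relations
agree.

The algebraic half (`IsMem.isCond`) derives the Guzmán–Squier identities from double negation, Or,
Abs, Mem and Com. Duality between `∧` and `∨` halves the work, and Com enters only to swap the two
branches of a conditional (`IsMem.cond_comm`). When `T` is available, double negation itself follows
(`Alg.sat_dnegAx_of_true`).

The semantic half first assumes a left unit `e` of `∧`. Every term then equals a decision tree with
nodes `x ∧ l ∨ ¬x ∧ r`. A tree `t` that is undefined whenever `x` is satisfies `(x ∨ ¬x) ∧ t = t`,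
so it may test `x` first; hence trees with equal truth values can be compared branch by branch
(`Tree.interp_eq_of_eval_eq`). Without a unit, let `a` be the atom that a term evaluates first. Then
`e = a ∨ ¬a` fixes the term from the left and is a unit of the subalgebra of the elements `x` with
`e ∧ x = x`. So `s` and `t` agree after either of their head tests, and such tests commute.

Independence is witnessed by algebras with at most four elements. -/

namespace CondLogic

/-! ### From the short axioms to those of Guzmán and Squier. -/

/-- An algebra `(A, neg, and, or)` that satisfies `¬¬x = x`, Or, Abs, Mem and Com. -/
structure IsMem {A : Type*} (neg : A → A) (and or : A → A → A) : Prop where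
  neg_neg x : neg (neg x) = x
  or_eq x y : or x y = neg (and (neg x) (neg y))
  absorb x y : and x (or x y) = x
  mem x y z : and (or x y) z = or (and (neg x) (and y z)) (and x z)
  com x y : or (and x y) (and y x) = or (and y x) (and x y)

/-- An algebra `(A, neg, and, or)` that satisfies the constant-free axioms of Guzmán and Squier. -/
structure IsCond {A : Type*} (neg : A → A) (and or : A → A → A) : Prop where
  neg_neg x : neg (neg x) = x
  neg_and x y : neg (and x y) = or (neg x) (neg y)
  assoc x y z : and (and x y) z = and x (and y z)
  distrib x y z : and x (or y z) = or (and x y) (and x z)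
  cond x y z : and (or x y) z = or (and x z) (and (neg x) (and y z))
  absorb x y : or x (and x y) = x
  com x y : or (and x y) (and y x) = or (and y x) (and x y)

section

variable {A : Type*} {neg : A → A} {and or : A → A → A}

local prefix:max "∼" => neg
local infixr:70 " ⋏ " => and
local infixr:65 " ⋎ " => or

namespace IsMem

theorem neg_and (h : IsMem neg and or) (x y : A) : ∼(x ⋏ y) = ∼x ⋎ ∼y := by
  rw [h.or_eq, h.neg_neg, h.neg_neg]

theorem neg_or (h : IsMem neg and or) (x y : A) : ∼(x ⋎ y) = ∼x ⋏ ∼y := by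
  rw [h.or_eq, h.neg_neg]

/-- Negation is an involution that exchanges `∧` and `∨`, so each consequence of the axioms yields
its dual for free. -/
theorem dual (h : IsMem neg and or) : IsMem neg or and where
  neg_neg := h.neg_neg
  or_eq x y := by rw [h.neg_or, h.neg_neg, h.neg_neg]
  absorb x y := by
    have := congrArg neg (h.absorb ∼x ∼y)
    simpa only [h.neg_and, h.neg_or, h.neg_neg] using this
  mem x y z := by
    have := congrArg neg (h.mem ∼x ∼y ∼z)
    simpa only [h.neg_and, h.neg_or, h.neg_neg] using this
  com x y := by
    have := congrArg neg (h.com ∼x ∼y)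
    simpa only [h.neg_and, h.neg_or, h.neg_neg] using this

theorem and_self (h : IsMem neg and or) (x : A) : x ⋏ x = x := by
  grind only [h.dual.absorb x x, h.absorb x (x ⋏ x)]

theorem mem_absorb_right (h : IsMem neg and or) (x y z : A) :
    ∼x ⋏ y ⋎ x ⋏ (y ⋎ z) = (x ⋎ y) ⋏ (y ⋎ z) := by
  grind only [h.absorb y z, h.mem x y (y ⋎ z)]

theorem neg_and_self_or (h : IsMem neg and or) (x : A) : ∼x ⋏ x ⋎ x = x := by
  grind only [h.absorb x x, h.mem_absorb_right x x x, h.dual.and_self x]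

theorem mem_absorb_left (h : IsMem neg and or) (x y z : A) :
    ∼x ⋏ y ⋏ (x ⋎ z) ⋎ x = (x ⋎ y) ⋏ (x ⋎ z) := by
  grind only [h.absorb x z, h.mem x y (x ⋎ z)]

theorem neg_or_self_or (h : IsMem neg and or) (x : A) : (∼x ⋎ x) ⋎ x = ∼x ⋎ x := by
  grind only [h.dual.neg_and_self_or x, h.dual.absorb (∼x ⋎ x) x]

theorem neg_and_or_and (h : IsMem neg and or) (x y : A) : ∼x ⋏ y ⋎ x ⋏ y = (x ⋎ y) ⋏ y := by
  grind only [h.and_self y, h.mem x y y]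

theorem neg_or_and_neg (h : IsMem neg and or) (x : A) : ∼x ⋎ x ⋏ ∼x = ∼x := by
  grind only [h.and_self ∼x, h.neg_and_or_and x ∼x, h.neg_neg x, h.dual.neg_and_self_or ∼x]

theorem neg_and_self (h : IsMem neg and or) (x : A) : ∼x ⋏ x = x ⋏ ∼x := by
  grind only [h.dual.and_self ∼x, h.neg_or_and_neg x, h.dual.mem_absorb_left x ∼x ∼x,
    h.dual.and_self (x ⋏ ∼x)]

theorem and_neg_and_self (h : IsMem neg and or) (x : A) : (x ⋏ ∼x) ⋏ x = x ⋏ ∼x := by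
  grind only [h.neg_and_self x, h.dual.neg_or_self_or x]

theorem neg_or_and_neg_or (h : IsMem neg and or) (x y : A) : ∼x ⋎ x ⋏ (∼x ⋎ y) = ∼x ⋎ y := by
  grind only [h.absorb ∼x y, h.neg_and_or_and x (∼x ⋎ y), h.neg_neg x, h.dual.mem ∼x ∼x y,
    h.and_self ∼x]

theorem mem_neg_absorb_right (h : IsMem neg and or) (x y z : A) :
    x ⋏ y ⋎ ∼x ⋏ (y ⋎ z) = (∼x ⋎ y) ⋏ (y ⋎ z) := by
  grind only [h.absorb y z, h.neg_neg x, h.mem ∼x y (y ⋎ z)]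

theorem or_neg_and_or (h : IsMem neg and or) (x y : A) : (x ⋎ ∼x) ⋏ (x ⋎ y) = x ⋎ y := by
  grind only [h.dual.neg_and_self x, h.mem_neg_absorb_right x x y, h.and_self x, h.neg_neg x,
    h.neg_or_and_neg_or ∼x y]

theorem and_neg_or_or (h : IsMem neg and or) (x y : A) : x ⋏ ∼x ⋎ x ⋎ y = x ⋎ y := by
  grind only [h.and_neg_and_self x, h.neg_and_self x, h.neg_neg x, h.neg_or x ∼x,
    h.or_neg_and_or x y, h.mem_absorb_right (x ⋎ ∼x) x y, h.dual.and_neg_and_self x]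

theorem or_and_or_neg (h : IsMem neg and or) (x y : A) : (x ⋎ y) ⋏ (x ⋎ ∼x) = x ⋎ y := by
  grind only [h.and_neg_or_or x y, h.neg_and_self x, h.neg_neg x, h.neg_or x ∼x,
    h.or_neg_and_or x y, h.dual.absorb (x ⋎ ∼x) (x ⋎ y), h.dual.neg_and_or_and (x ⋎ ∼x) (x ⋎ y),
    h.dual.and_self (x ⋎ y)]

theorem or_neg_or (h : IsMem neg and or) (x y : A) : x ⋎ ∼x ⋎ y = x ⋎ ∼x := by
  grind only [h.or_and_or_neg x (∼x ⋎ y), h.mem_absorb_left x (∼x ⋎ y) ∼x, h.dual.neg_and_self x,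
    h.neg_neg x, h.or_and_or_neg ∼x y, h.absorb ∼x y]

theorem or_or_or_and_neg_or (h : IsMem neg and or) (x y : A) :
    (x ⋎ x ⋎ y) ⋎ x ⋏ ∼x ⋎ y = x ⋎ x ⋎ y := by
  grind only [h.neg_neg x, h.neg_and_self x, h.dual.mem ∼x x y,
    h.dual.absorb (∼∼x ⋎ x ⋎ y) (∼x ⋎ y)]

theorem neg_and_and_or_or (h : IsMem neg and or) (x y z : A) : ∼x ⋏ (x ⋏ y ⋎ z) ⋎ x = x ⋎ z := by
  grind only [h.dual.mem x y z, h.mem_absorb_left x (∼x ⋎ y ⋎ z) z, h.or_neg_or x (y ⋎ z),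
    h.or_neg_and_or x z]

theorem or_neg_and_or_self (h : IsMem neg and or) (x y : A) : x ⋎ ∼x ⋏ (x ⋎ y) = x ⋎ y := by
  grind only [h.and_self x, h.mem_neg_absorb_right x x y, h.dual.neg_and_self x,
    h.or_neg_and_or x y]

theorem neg_and_or_or_self (h : IsMem neg and or) (x y : A) : ∼x ⋏ (x ⋎ y) ⋎ x = x ⋎ y := by
  grind only [h.absorb x x, h.neg_and_and_or_or x (x ⋎ x) y]

theorem neg_or_and_and (h : IsMem neg and or) (x y z : A) : (∼x ⋎ y) ⋏ x ⋏ z = x ⋏ y ⋏ x ⋏ z := by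
  grind only [h.neg_and_self x, h.neg_neg x, h.dual.or_neg_or ∼x z, h.mem ∼x y (∼∼x ⋏ z),
    h.dual.or_and_or_neg x (y ⋏ x ⋏ z)]

theorem neg_or_and_self (h : IsMem neg and or) (x y : A) : (∼x ⋎ y) ⋏ x = x ⋏ y ⋏ x := by
  grind only [h.neg_neg x, h.neg_and_self x, h.mem ∼x y x, h.dual.or_and_or_neg x (y ⋏ x)]

theorem and_or_and_and_self (h : IsMem neg and or) (x y z : A) :
    x ⋏ ((x ⋎ y) ⋏ z) ⋏ x = x ⋏ z := by
  grind only [h.neg_or_and_self x ((x ⋎ y) ⋏ z), h.dual.neg_and_and_or_or x y z]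

theorem and_and_and_self (h : IsMem neg and or) (x y : A) : x ⋏ (x ⋏ y) ⋏ x = x ⋏ y := by
  grind only [h.neg_or_and_self x (x ⋏ y), h.dual.neg_and_or_or_self x y]

theorem and_and_self_left (h : IsMem neg and or) (x y : A) : x ⋏ x ⋏ y = x ⋏ y := by
  grind only [h.dual.or_and_or_neg x (x ⋏ y), h.dual.mem_absorb_left x (x ⋏ y) ∼x,
    h.dual.or_and_or_neg x y, h.neg_or_and_self x (x ⋏ y), h.and_and_and_self x y]

theorem or_and_self_right (h : IsMem neg and or) (x y : A) : (x ⋎ y) ⋏ y = (x ⋎ ∼x) ⋏ y := by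
  grind only [h.neg_and_or_and x y, h.and_and_self_left ∼x y, h.mem x ∼x y]

theorem neg_and_and_neg (h : IsMem neg and or) (x y : A) : ∼x ⋏ y ⋏ ∼x = ∼x ⋏ (x ⋎ y) := by
  grind only [h.neg_neg x, h.dual.neg_or_and_neg x, h.neg_or_and_and ∼x y (x ⋎ ∼x),
    h.or_neg_and_or_self x y, h.neg_or_and_and ∼x (∼x ⋏ (x ⋎ y)) (x ⋎ ∼x),
    h.and_and_and_self ∼x (x ⋎ y)]

theorem and_neg_or_or_neg (h : IsMem neg and or) (x y : A) : x ⋏ (∼x ⋎ y ⋎ ∼x) = x ⋏ y := by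
  grind only [h.dual.neg_and_and_neg x y, h.dual.or_neg_and_or_self x y]

theorem and_neg_or_or_and (h : IsMem neg and or) (x y z : A) :
    x ⋏ (∼x ⋎ (x ⋎ y) ⋏ z) = x ⋏ z := by
  grind only [h.neg_neg x, h.neg_and_and_neg ∼x ((x ⋎ y) ⋏ z), h.and_or_and_and_self x y z]

theorem and_or_and (h : IsMem neg and or) (x y z : A) : x ⋏ (x ⋎ z) ⋏ y = x ⋏ y := by
  grind only [h.and_or_and_and_self x z ((x ⋎ z) ⋏ y), h.and_and_self_left (x ⋎ z) y,
    h.neg_neg x, h.neg_and_and_neg ∼x ((x ⋎ z) ⋏ y), h.and_neg_or_or_and x z y]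

theorem or_or_and_neg (h : IsMem neg and or) (x y : A) : (x ⋎ y) ⋎ x ⋏ ∼x = x ⋎ y := by
  grind only [h.or_neg_and_or x y, h.dual.neg_and_self x, h.neg_neg x, h.neg_and x ∼x,
    h.and_neg_or_or x y, h.neg_and_or_or_self (x ⋏ ∼x) (x ⋎ y)]

theorem or_or_self_right (h : IsMem neg and or) (x y : A) : (x ⋎ y) ⋎ y = x ⋎ y := by
  grind only [h.dual.and_or_and (x ⋎ y) y y, h.or_and_self_right x y,
    h.dual.or_and_self_right (x ⋎ ∼x) y, h.neg_or x ∼x, h.neg_neg x, h.neg_and_self x,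
    h.dual.and_neg_or_or x ∼x, h.dual.and_and_self_left x y, h.or_or_or_and_neg_or x y]

theorem and_or_neg (h : IsMem neg and or) (x y : A) : x ⋏ (y ⋎ ∼x) = x ⋏ y := by
  grind only [h.and_neg_or_or_neg x (y ⋎ ∼x), h.or_or_self_right y ∼x, h.and_neg_or_or_neg x y]

theorem and_or_neg_and_neg (h : IsMem neg and or) (x y z : A) : x ⋏ (y ⋎ ∼x ⋏ ∼z) = x ⋏ y := by
  grind only [h.neg_or x z, h.and_neg_or_or_and x z (y ⋎ ∼(x ⋎ z)), h.and_or_neg (x ⋎ z) y,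
    h.and_neg_or_or_and x z y]

theorem and_neg_or_and (h : IsMem neg and or) (x y z : A) : x ⋏ (∼x ⋎ y) ⋏ z = x ⋏ y ⋏ z := by
  grind only [h.mem ∼x y z, h.neg_neg z, h.and_or_neg_and_neg x (∼∼x ⋏ y ⋏ z) ∼z, h.neg_neg x,
    h.and_and_self_left x (y ⋏ z)]

theorem and_and_self_and (h : IsMem neg and or) (x y z : A) : x ⋏ (y ⋏ x) ⋏ z = x ⋏ y ⋏ z := by
  grind only [h.neg_neg x, h.and_neg_or_and x (y ⋏ ∼∼x) z, h.dual.and_or_neg ∼x y,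
    h.and_neg_or_and x y z]

theorem or_or_self (h : IsMem neg and or) (x y : A) : x ⋎ y ⋎ x = x ⋎ y := by
  grind only [h.or_or_and_neg y x, h.dual.and_and_self_and x y (y ⋏ ∼y), h.dual.absorb y ∼y]

theorem and_neg_or (h : IsMem neg and or) (x y : A) : x ⋏ (∼x ⋎ y) = x ⋏ y := by
  grind only [h.or_or_self ∼x y, h.and_neg_or_or_neg x y]

theorem and_and_and_left (h : IsMem neg and or) (x y z : A) : (x ⋏ y) ⋏ x ⋏ z = (x ⋏ y) ⋏ z := by
  grind only [h.and_and_self_and (x ⋏ y) x z, h.and_and_self_left x y,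
    h.and_and_self_left (x ⋏ y) z]

theorem and_neg_and (h : IsMem neg and or) (x y : A) : (x ⋏ ∼x) ⋏ y = x ⋏ ∼x := by
  grind only [h.and_and_and_left x ∼x y, h.dual.or_neg_and_or x y, h.absorb (x ⋏ ∼x) (x ⋏ y)]

theorem neg_or_and (h : IsMem neg and or) (x y : A) : (∼x ⋎ y) ⋏ x = x ⋏ y := by
  grind only [h.mem ∼x y x, h.neg_and_self x, h.neg_neg x, h.dual.or_or_self x y,
    h.dual.or_and_or_neg x y]

theorem and_and_and_left_idem (h : IsMem neg and or) (x y z : A) :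
    x ⋏ (x ⋏ y) ⋏ z = x ⋏ y ⋏ z := by
  grind only [h.neg_neg x, h.and_neg_or_and x (∼∼x ⋏ y) z, h.dual.and_neg_or ∼x y,
    h.and_neg_or_and x y z]

theorem and_left_idem_right (h : IsMem neg and or) (x y z : A) : x ⋏ y ⋏ x ⋏ z = x ⋏ y ⋏ z := by
  grind only [h.and_and_and_left_idem y x z, h.and_and_self_and x y ((y ⋏ x) ⋏ z),
    h.and_and_self_left (y ⋏ x) z, h.and_and_self_and x y z]

theorem and_and_neg_or (h : IsMem neg and or) (x y z : A) : x ⋏ y ⋏ (∼x ⋎ z) = x ⋏ y ⋏ z := by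
  grind only [h.and_left_idem_right x y (∼x ⋎ z), h.and_neg_or x z, h.and_left_idem_right x y z]

theorem or_and_distrib (h : IsMem neg and or) (x y z : A) : (x ⋎ y) ⋏ (x ⋎ z) = x ⋎ y ⋏ z := by
  grind only [h.neg_neg x, h.mem x y (∼∼x ⋎ z), h.and_and_neg_or ∼x y z, h.absorb x z,
    h.dual.neg_or_and x (y ⋏ z)]

theorem neg_and_or_and_neg (h : IsMem neg and or) (x y : A) : ∼x ⋏ y ⋎ x ⋏ ∼x = ∼x ⋏ y := by
  grind only [h.dual.or_or_self ∼x y, h.mem x y ∼x, h.neg_neg x, h.neg_or_and ∼x y]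

theorem or_and_neg_and (h : IsMem neg and or) (x y z : A) : (x ⋎ y) ⋏ ∼x ⋏ z = ∼x ⋏ y ⋏ z := by
  grind only [h.and_left_idem_right ∼x y z, h.dual.or_neg_or x z, h.mem x y (∼x ⋏ z),
    h.neg_and_or_and_neg x (y ⋏ z)]

/-- First `z` may be replaced by `¬x ∧ z`. In front of `¬x ∧ z`, the factor `¬x ∧ y` may be weakened
to `x ∨ y`, and `or_and_neg_and` finishes. The form with `¬x` is the one that Mem produces; it loses
nothing, since every element is a negation. -/
theorem neg_and_assoc (h : IsMem neg and or) (x y z : A) : (∼x ⋏ y) ⋏ z = ∼x ⋏ y ⋏ z := by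
  grind only [h.and_and_and_left ∼x y z, h.neg_neg x, h.neg_or_and ∼x y, h.mem x y ∼x,
    h.and_neg_and x (∼x ⋏ z), h.mem (∼x ⋏ y ⋏ ∼x) (x ⋏ ∼x) (∼x ⋏ z), h.dual.or_neg_or x z,
    h.mem (∼x ⋏ y ⋏ ∼x) x (∼x ⋏ z), h.dual.or_or_self ∼x y, h.dual.neg_or_and x y,
    h.or_and_neg_and x y z]

theorem and_assoc (h : IsMem neg and or) (x y z : A) : (x ⋏ y) ⋏ z = x ⋏ y ⋏ z := by
  simpa only [h.neg_neg] using h.neg_and_assoc ∼x y z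

theorem and_and_or (h : IsMem neg and or) (x y z : A) : x ⋏ y ⋏ (x ⋎ z) = x ⋏ y := by
  grind only [h.and_or_and x (y ⋏ (x ⋎ z)) z, h.dual.or_or_self (x ⋎ z) y, h.and_or_and x y z]

theorem or_and_neg_or (h : IsMem neg and or) (x y z : A) :
    (x ⋎ y) ⋏ (∼x ⋎ z) = ∼x ⋏ y ⋎ x ⋏ z := by
  grind only [h.mem x y (∼x ⋎ z), h.and_neg_or x z, h.and_and_or ∼x y z]

/-- Put `a = x ∧ y` and `b = ¬x ∧ z`. The two products of `¬x ∨ y` and `x ∨ z` are `a ∨ b` and `b ∨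
a`, so Com gives `(a ∨ b) ∨ (b ∨ a) = (b ∨ a) ∨ (a ∨ b)`. The sides collapse to `a ∨ b` and `b ∨ a`.
-/
theorem cond_comm (h : IsMem neg and or) (x y z : A) :
    x ⋏ y ⋎ ∼x ⋏ z = ∼x ⋏ z ⋎ x ⋏ y := by
  grind only [h.or_or_self (x ⋏ y) (∼x ⋏ z), h.or_or_self (∼x ⋏ z) (x ⋏ y),
    h.dual.and_and_self_left (∼x ⋏ z) (x ⋏ y), h.dual.and_and_self_left (x ⋏ y) (∼x ⋏ z),
    h.dual.and_assoc (x ⋏ y) (∼x ⋏ z) (∼x ⋏ z ⋎ x ⋏ y),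
    h.dual.and_assoc (∼x ⋏ z) (x ⋏ y) (x ⋏ y ⋎ ∼x ⋏ z),
    h.or_and_neg_or x z y, h.dual.or_and_neg_or x y z, h.com (∼x ⋎ y) (x ⋎ z)]

theorem isCond (h : IsMem neg and or) : IsCond neg and or where
  neg_neg := h.neg_neg
  neg_and := h.neg_and
  assoc := h.and_assoc
  distrib x y z := (h.dual.or_and_distrib x y z).symm
  cond x y z := by rw [h.mem, h.cond_comm]
  absorb := h.dual.absorb
  com := h.com

end IsMem

end

/-! ### Calculus of conditionals and tests in the Guzmán–Squier algebras. -/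

section

variable {A : Type*} {neg : A → A} {and or : A → A → A}

local prefix:max "∼" => neg
local infixr:70 " ⋏ " => and
local infixr:65 " ⋎ " => or

namespace IsCond

theorem neg_or (h : IsCond neg and or) (x y : A) : ∼(x ⋎ y) = ∼x ⋏ ∼y := by
  rw [← h.neg_neg (∼x ⋏ ∼y), h.neg_and, h.neg_neg, h.neg_neg]

theorem dual (h : IsCond neg and or) : IsCond neg or and where
  neg_neg := h.neg_neg
  neg_and := h.neg_or
  assoc x y z := by
    simpa only [h.neg_and, h.neg_neg] using congrArg neg (h.assoc ∼x ∼y ∼z)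
  distrib x y z := by
    simpa only [h.neg_and, h.neg_or, h.neg_neg] using congrArg neg (h.distrib ∼x ∼y ∼z)
  cond x y z := by
    simpa only [h.neg_and, h.neg_or, h.neg_neg] using congrArg neg (h.cond ∼x ∼y ∼z)
  absorb x y := by
    simpa only [h.neg_and, h.neg_or, h.neg_neg] using congrArg neg (h.absorb ∼x ∼y)
  com x y := by
    simpa only [h.neg_and, h.neg_or, h.neg_neg] using congrArg neg (h.com ∼x ∼y)

theorem and_self (h : IsCond neg and or) (x : A) : x ⋏ x = x := by
  grind only [h.dual.absorb x (x ⋏ x), h.absorb x x]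

theorem and_and_self_left (h : IsCond neg and or) (x y : A) : x ⋏ x ⋏ y = x ⋏ y := by
  rw [← h.assoc, h.and_self]

theorem and_and_self (h : IsCond neg and or) (x y : A) : x ⋏ y ⋏ x = x ⋏ y := by
  -- Com for `x ∧ y` and `x` identifies `x ∧ (y ∧ x ∨ y)` with `x ∧ y ∨ x ∧ y ∧ x`, which `x ∧ y`
  -- absorbs. Rebracketed, the left side is `x ∧ y ∧ x` by absorption.
  have hc : (x ⋏ y) ⋏ x ⋏ (y ⋏ x ⋎ y) = x ⋏ y := by
    have := h.com (x ⋏ y) x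
    grind only [h.distrib x (y ⋏ x) y, h.assoc x y x, h.and_and_self_left x y,
      h.dual.absorb (x ⋏ y) (x ⋏ y ⋏ x)]
  grind only [h.assoc x y (x ⋏ (y ⋏ x ⋎ y)), h.assoc y x (y ⋏ x ⋎ y), h.dual.absorb (y ⋏ x) y]

/-- Compute `x ∧ (x ∧ y ∨ y)` twice: distributivity gives `x ∧ y`, while `x ∧ y ∨ y = (x ∨ y) ∧ (¬x
∨ y)` and absorption give `x ∧ (¬x ∨ y)`. -/
theorem and_neg_or (h : IsCond neg and or) (x y : A) : x ⋏ (∼x ⋎ y) = x ⋏ y := by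
  grind only [h.and_self y, h.dual.cond x y y, h.dual.distrib x y y,
    h.assoc x (x ⋎ y) (∼x ⋎ y ⋎ y), h.dual.absorb x y, h.dual.and_self y,
    h.distrib x (x ⋏ y) y, h.and_and_self_left x y, h.dual.and_self (x ⋏ y)]

theorem and_neg_and (h : IsCond neg and or) (x y : A) : x ⋏ ∼x ⋏ y = x ⋏ ∼x := by
  grind only [h.and_neg_or x (∼x ⋏ y), h.absorb ∼x y]

theorem and_and_self_and (h : IsCond neg and or) (x y z : A) : x ⋏ y ⋏ x ⋏ z = x ⋏ y ⋏ z := by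
  rw [← h.assoc y, ← h.assoc x, h.and_and_self, h.assoc]

theorem and_and_or (h : IsCond neg and or) (x y z : A) : x ⋏ y ⋏ (x ⋎ z) = x ⋏ y := by
  rw [← h.and_and_self_and, h.dual.absorb, h.and_and_self]

theorem or_and_neg_or (h : IsCond neg and or) (x y z : A) :
    (x ⋎ y) ⋏ (∼x ⋎ z) = x ⋏ z ⋎ ∼x ⋏ y := by
  rw [h.cond, h.and_neg_or, h.and_and_or]

theorem cond_comm (h : IsCond neg and or) (x y z : A) :
    x ⋏ y ⋎ ∼x ⋏ z = ∼x ⋏ z ⋎ x ⋏ y := by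
  grind only [h.dual.and_and_self (x ⋏ y) (∼x ⋏ z), h.dual.and_and_self (∼x ⋏ z) (x ⋏ y),
    h.dual.and_and_self_left (∼x ⋏ z) (x ⋏ y), h.dual.and_and_self_left (x ⋏ y) (∼x ⋏ z),
    h.dual.assoc (x ⋏ y) (∼x ⋏ z) (∼x ⋏ z ⋎ x ⋏ y),
    h.dual.assoc (∼x ⋏ z) (x ⋏ y) (x ⋏ y ⋎ ∼x ⋏ z),
    h.or_and_neg_or x z y, h.or_and_neg_or ∼x y z, h.neg_neg x, h.com (∼x ⋎ y) (x ⋎ z)]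

theorem or_neg_comm (h : IsCond neg and or) (x : A) : x ⋎ ∼x = ∼x ⋎ x := by
  simpa only [h.and_self] using h.cond_comm x x ∼x

theorem neg_cond (h : IsCond neg and or) (x y z : A) :
    ∼(x ⋏ y ⋎ ∼x ⋏ z) = x ⋏ ∼y ⋎ ∼x ⋏ ∼z := by
  rw [h.neg_or, h.neg_and, h.neg_and, h.neg_neg, h.cond_comm x]
  simpa only [h.neg_neg] using h.or_and_neg_or ∼x ∼y ∼z

theorem cond_and (h : IsCond neg and or) (x y z w : A) :
    (x ⋏ y ⋎ ∼x ⋏ z) ⋏ w = x ⋏ y ⋏ w ⋎ ∼x ⋏ z ⋏ w := by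
  rw [← h.or_and_neg_or, h.assoc, h.cond, ← h.assoc x, h.and_neg_or, h.assoc,
    ← h.assoc z, ← h.assoc ∼x, h.and_and_or, h.assoc]

theorem and_cond (h : IsCond neg and or) (x y z : A) : x ⋏ (x ⋏ y ⋎ ∼x ⋏ z) = x ⋏ y := by
  have hx : x ⋏ ∼x = ∼x ⋏ x := h.dual.or_neg_comm x
  rw [h.distrib, h.and_and_self_left, h.and_neg_and, hx, h.cond_comm, ← hx, ← h.distrib,
    h.and_neg_or]

theorem neg_and_cond (h : IsCond neg and or) (x y z : A) :
    ∼x ⋏ (x ⋏ y ⋎ ∼x ⋏ z) = ∼x ⋏ z := by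
  simpa only [h.neg_neg, h.cond_comm x y z] using h.and_cond ∼x z y

theorem and_cond_and (h : IsCond neg and or) (x y z w : A) :
    x ⋏ (y ⋏ x ⋏ z ⋎ ∼y ⋏ x ⋏ w) = x ⋏ (y ⋏ z ⋎ ∼y ⋏ w) := by
  rw [h.distrib, h.and_and_self_and, h.and_and_self_and, ← h.distrib]

theorem or_neg_and (h : IsCond neg and or) (x y : A) : (x ⋎ ∼x) ⋏ y = x ⋏ y ⋎ ∼x ⋏ y := by
  rw [h.cond, h.and_and_self_left]

theorem or_neg_or (h : IsCond neg and or) (x y : A) : (x ⋎ ∼x) ⋎ y = x ⋎ ∼x := by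
  rw [h.dual.assoc, h.dual.and_neg_and]

theorem or_neg_and_cond (h : IsCond neg and or) (x y z : A) :
    (x ⋎ ∼x) ⋏ (x ⋏ y ⋎ ∼x ⋏ z) = x ⋏ y ⋎ ∼x ⋏ z := by
  rw [h.or_neg_and, h.and_cond, h.neg_and_cond]

theorem and_or_of_or (h : IsCond neg and or) {x y : A} (hx : ∀ z, x ⋎ z = x)
    (hy : ∀ z, y ⋎ z = y) (z : A) : x ⋏ y ⋎ z = x ⋏ y := by
  rw [h.dual.cond, hx, hy, h.and_neg_or]

/-- Left zeros of `∨` play the role of tests that are never false, such as `x ∨ ¬x`. Their products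
are again left zeros, so both sides of Com lose their second disjunct. -/
theorem and_comm_of_or (h : IsCond neg and or) {x y : A} (hx : ∀ z, x ⋎ z = x)
    (hy : ∀ z, y ⋎ z = y) : x ⋏ y = y ⋏ x := by
  have := h.com x y
  rwa [h.and_or_of_or hx hy, h.and_or_of_or hy hx] at this

theorem or_neg_and_comm (h : IsCond neg and or) (x y : A) :
    (x ⋎ ∼x) ⋏ (y ⋎ ∼y) = (y ⋎ ∼y) ⋏ (x ⋎ ∼x) :=
  h.and_comm_of_or (h.or_neg_or x) (h.or_neg_or y)

/-- As `e` is never false, both sides run `x` exactly when `e` is true. This lets `e ∧ ·` pass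
through negation. -/
theorem neg_or_of_or (h : IsCond neg and or) {e : A} (he : ∀ z, e ⋎ z = e) (x : A) :
    ∼e ⋎ x = e ⋏ x := by
  have h1 : ∼e ⋏ e = ∼e := by simpa only [h.neg_or, h.neg_neg] using congrArg neg (he ∼e)
  have h2 := h.dual.cond e ∼e x
  rw [h.dual.or_neg_comm e, h1, he, h.dual.and_and_self_left, h.and_neg_or] at h2
  exact h2

/-- Exchange of two nested tests. -/
theorem cond_or_neg_and (h : IsCond neg and or) (x y z w : A) :
    y ⋏ (x ⋎ ∼x) ⋏ z ⋎ ∼y ⋏ (x ⋎ ∼x) ⋏ w = (x ⋎ ∼x) ⋏ (y ⋏ z ⋎ ∼y ⋏ w) := by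
  -- Insert the test `y ∨ ¬y`, which the conditional on `y` tolerates, move it in front of `x ∨ ¬x`,
  -- and split on it.
  rw [← h.or_neg_and_cond y z w, ← h.assoc (x ⋎ ∼x), h.or_neg_and_comm x y, h.assoc, h.or_neg_and y]
  rw [← h.and_and_self_and y (x ⋎ ∼x) (y ⋏ z ⋎ ∼y ⋏ w), h.and_cond,
    ← h.and_and_self_and ∼y (x ⋎ ∼x) (y ⋏ z ⋎ ∼y ⋏ w), h.neg_and_cond, h.and_and_self_and,
    h.and_and_self_and]

theorem and_of_neg_eq (h : IsCond neg and or) {u : A} (hu : ∼u = u) (x : A) : u ⋏ x = u := by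
  have := h.and_neg_and u x
  rwa [hu, h.and_and_self_left, h.and_self] at this

/-- Here `u = u ∨ ¬u` is itself a test, so it commutes with `x ∨ ¬x`; and `u` is a left zero of `∧`.
-/
theorem or_neg_and_of_neg_eq (h : IsCond neg and or) {u : A} (hu : ∼u = u) (x : A) :
    (x ⋎ ∼x) ⋏ u = u := by
  have := h.or_neg_and_comm x u
  rwa [hu, h.dual.and_self, h.and_of_neg_eq hu] at this

theorem and_one (h : IsCond neg and or) {e : A} (he : ∀ x, e ⋏ x = x) (x : A) : x ⋏ e = x := by
  rw [← he (x ⋏ e), h.and_and_self, he]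

theorem one_or (h : IsCond neg and or) {e : A} (he : ∀ x, e ⋏ x = x) (x : A) : e ⋎ x = e := by
  rw [← he (e ⋎ x), h.dual.absorb]

theorem zero_and (h : IsCond neg and or) {e : A} (he : ∀ x, e ⋏ x = x) (x : A) :
    ∼e ⋏ x = ∼e := by
  simpa only [h.neg_or, h.neg_neg] using congrArg neg (h.one_or he ∼x)

theorem or_zero (h : IsCond neg and or) {e : A} (he : ∀ x, e ⋏ x = x) (x : A) : x ⋎ ∼e = x := by
  simpa only [h.neg_and, h.neg_neg] using congrArg neg (h.and_one he ∼x)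

theorem cond_one_zero (h : IsCond neg and or) {e : A} (he : ∀ x, e ⋏ x = x) (x : A) :
    x ⋏ e ⋎ ∼x ⋏ ∼e = x := by
  rw [h.and_one he, h.dual.and_neg_or, h.or_zero he]

end IsCond

end

/-! ### Algebras and decision trees. -/

/-- An algebra over the signature with a constant for each element of `S`. -/
structure Alg (S : Set TV) (A : Type*) where
  neg : A → A
  and : A → A → A
  or : A → A → A
  const : S → A

/-- The value of a term in an algebra. -/
def Term.interp {S : Set TV} {A : Type*} (M : Alg S A) {X : Type*} (v : X → A) : Term S X → A
  | var x => v x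
  | const c => M.const c
  | neg t => M.neg (t.interp M v)
  | and s t => M.and (s.interp M v) (t.interp M v)
  | or s t => M.or (s.interp M v) (t.interp M v)

/-- Decision trees, with an undefined leaf only if `p` holds. -/
inductive Tree (p : Prop) (X : Type u) : Type u
  | leaf (b : Bool) : Tree p X
  | undef (h : p) : Tree p X
  | node (x : X) (l r : Tree p X) : Tree p X

namespace Tree

variable {p : Prop} {X : Type u}

/-- The truth value of a decision tree. -/
def eval (v : X → TV) : Tree p X → TV
  | leaf true => TV.T
  | leaf false => TV.F
  | undef _ => TV.U
  | node x l r => ((v x).and (l.eval v)).or ((v x).neg.and (r.eval v))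

/-- The value of a decision tree in an algebra, with `e` for truth. -/
def interp {A : Type*} (neg : A → A) (and or : A → A → A) (e : A) (u : p → A) (v : X → A) :
    Tree p X → A
  | leaf true => e
  | leaf false => neg e
  | undef h => u h
  | node x l r => or (and (v x) (l.interp neg and or e u v))
      (and (neg (v x)) (r.interp neg and or e u v))

/-- The number of inner nodes. -/
def size : Tree p X → ℕ
  | leaf _ => 0
  | undef _ => 0
  | node _ l r => l.size + r.size + 1

/-- Negation of a decision tree. -/
def neg : Tree p X → Tree p X
  | leaf b => leaf !b
  | undef h => undef h
  | node x l r => node x l.neg r.neg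

/-- Conjunction of decision trees: graft the second tree on the true leaves of the first. -/
def and : Tree p X → Tree p X → Tree p X
  | leaf true, t => t
  | leaf false, _ => leaf false
  | undef h, _ => undef h
  | node x l r, t => node x (l.and t) (r.and t)

/-- The truth value of a Boolean. -/
def ofBool : Bool → TV
  | true => TV.T
  | false => TV.F

/-- The tree that remains after the variable `x` has been found to have the value `b`. -/
def restrict [DecidableEq X] (x : X) (b : Bool) : Tree p X → Tree p X
  | leaf c => leaf c
  | undef h => undef h
  | node y l r =>
    if y = x then bif b then l.restrict x b else r.restrict x b
    else node y (l.restrict x b) (r.restrict x b)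

theorem eval_neg (v : X → TV) (t : Tree p X) : t.neg.eval v = (t.eval v).neg := by
  induction t with
  | leaf b => cases b <;> rfl
  | undef h => rfl
  | node x l r hl hr =>
    simp only [neg, eval, hl, hr]
    cases v x <;> cases l.eval v <;> cases r.eval v <;> rfl

theorem eval_and (v : X → TV) (s t : Tree p X) :
    (s.and t).eval v = (s.eval v).and (t.eval v) := by
  induction s with
  | leaf b => cases b <;> rfl
  | undef h => rfl
  | node x l r hl hr =>
    simp only [and, eval, hl, hr]
    cases v x <;> cases l.eval v <;> cases r.eval v <;> cases t.eval v <;> rfl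

section Restrict

variable [DecidableEq X]

theorem size_restrict_le (x : X) (b : Bool) (t : Tree p X) : (t.restrict x b).size ≤ t.size := by
  induction t with
  | leaf => rfl
  | undef => rfl
  | node y l r hl hr =>
    unfold restrict
    split
    · cases b <;> simp only [cond_true, cond_false, size] <;> omega
    · simp only [size]; omega

theorem size_restrict_lt (x : X) (b : Bool) (l r : Tree p X) :
    ((node x l r).restrict x b).size < (node x l r).size := by
  have hl := size_restrict_le x b l
  have hr := size_restrict_le x b r
  cases b <;> simp only [restrict, if_true, cond_true, cond_false, size] <;> omega

theorem eval_restrict (v : X → TV) (x : X) (b : Bool) (t : Tree p X) :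
    (t.restrict x b).eval v = t.eval (Function.update v x (ofBool b)) := by
  induction t with
  | leaf c => cases c <;> rfl
  | undef => rfl
  | node y l r hl hr =>
    unfold restrict
    split
    · subst y
      have hT (a c : TV) : ((TV.T.and a).or (TV.T.neg.and c)) = a := by cases a <;> rfl
      have hF (a c : TV) : ((TV.F.and a).or (TV.F.neg.and c)) = c := rfl
      cases b <;> simp only [cond_true, cond_false, hl, hr, eval, Function.update_self, ofBool,
        hT, hF]
    · next hy => simp only [eval, hl, hr, Function.update_of_ne hy]

end Restrict

theorem eval_eq_undef_of_node {x : X} {v : X → TV} (hv : v x = TV.U) (l r : Tree p X) :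
    (node x l r).eval v = TV.U := by
  simp only [eval, hv]; rfl

section Interp

variable {A : Type*} {neg' : A → A} {and' or' : A → A → A} {e : A} {u : p → A}

local notation "⟦" t "⟧[" v "]" => interp neg' and' or' e u v t

theorem interp_neg (h : IsCond neg' and' or') (hu : ∀ hp, neg' (u hp) = u hp) (v : X → A)
    (t : Tree p X) : ⟦t.neg⟧[v] = neg' ⟦t⟧[v] := by
  induction t with
  | leaf b => cases b <;> simp only [neg, interp, Bool.not_true, Bool.not_false, h.neg_neg]
  | undef hp => exact (hu hp).symm
  | node x l r hl hr => simp only [neg, interp, hl, hr, h.neg_cond]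

theorem interp_and (h : IsCond neg' and' or') (he : ∀ x, and' e x = x)
    (hu : ∀ hp, neg' (u hp) = u hp) (v : X → A) (s t : Tree p X) :
    ⟦s.and t⟧[v] = and' ⟦s⟧[v] ⟦t⟧[v] := by
  induction s with
  | leaf b => cases b <;> simp only [and, interp, he, h.zero_and he]
  | undef hp => exact (h.and_of_neg_eq (hu hp) _).symm
  | node x l r hl hr => simp only [and, interp, hl, hr, h.cond_and]

variable [DecidableEq X]

/-- Once `x` has been found true, later tests of `x` are redundant; `and_cond_and` carries the guard
`x` past a test of another variable. -/
theorem and_interp_restrict_true (h : IsCond neg' and' or') (v : X → A) (x : X) (t : Tree p X) :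
    and' (v x) ⟦t.restrict x true⟧[v] = and' (v x) ⟦t⟧[v] := by
  induction t with
  | leaf => rfl
  | undef => rfl
  | node y l r hl hr =>
    unfold restrict
    split
    · subst y; simp only [cond_true, interp, h.and_cond, hl]
    · simp only [interp]
      rw [← h.and_cond_and, hl, hr, h.and_cond_and]

theorem and_interp_restrict_false (h : IsCond neg' and' or') (v : X → A) (x : X)
    (t : Tree p X) :
    and' (neg' (v x)) ⟦t.restrict x false⟧[v] = and' (neg' (v x)) ⟦t⟧[v] := by
  induction t with
  | leaf => rfl
  | undef => rfl
  | node y l r hl hr =>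
    unfold restrict
    split
    · subst y; simp only [cond_false, interp, h.neg_and_cond, hr]
    · simp only [interp]
      rw [← h.and_cond_and, hl, hr, h.and_cond_and]

/-- If `t` is undefined whenever `x` is, then `t` may evaluate `x` first. -/
theorem or_neg_and_interp (h : IsCond neg' and' or') (hu : ∀ hp, neg' (u hp) = u hp)
    (v : X → A) (x : X) (t : Tree p X) (ht : ∀ w : X → TV, w x = TV.U → t.eval w = TV.U) :
    and' (or' (v x) (neg' (v x))) ⟦t⟧[v] = ⟦t⟧[v] := by
  -- The induction is on size, because the recursion goes to restrictions of the subtrees.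
  induction hn : t.size using Nat.strong_induction_on generalizing t with
  | _ n ih =>
  match t with
  | leaf true => cases ht (fun _ => TV.U) rfl
  | leaf false => cases ht (fun _ => TV.U) rfl
  | undef hp => exact h.or_neg_and_of_neg_eq (hu hp) _
  | node y l r =>
    by_cases hyx : y = x
    · subst y; exact h.or_neg_and_cond _ _ _
    -- Making `y` true leaves `x` undefined, so `t` is still undefined, and then its value comes
    -- from `l`. Restriction removes the dependence on the original value of `y`.
    · have hl : ∀ w : X → TV, w x = TV.U → (l.restrict y true).eval w = TV.U := by
        intro w hw
        rw [eval_restrict]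
        have := ht (Function.update w y TV.T) (by rwa [Function.update_of_ne (Ne.symm hyx)])
        rw [eval, Function.update_self] at this
        change ((l.eval (Function.update w y TV.T)).or TV.F) = TV.U at this
        change l.eval (Function.update w y TV.T) = TV.U
        revert this
        cases l.eval (Function.update w y TV.T) <;> exact id
      have hr : ∀ w : X → TV, w x = TV.U → (r.restrict y false).eval w = TV.U := by
        intro w hw
        rw [eval_restrict]
        have := ht (Function.update w y TV.F) (by rwa [Function.update_of_ne (Ne.symm hyx)])
        rw [eval, Function.update_self] at this
        exact this
      have sl := size_restrict_le y true l
      have sr := size_restrict_le y false r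
      simp only [size] at hn
      have il := ih _ (by omega) (l.restrict y true) hl rfl
      have ir := ih _ (by omega) (r.restrict y false) hr rfl
      rw [interp, ← and_interp_restrict_true h, ← and_interp_restrict_false h,
        ← h.cond_or_neg_and, il, ir]

/-- Decision trees with the same truth values have the same value in all algebras. -/
theorem interp_eq_of_eval_eq (h : IsCond neg' and' or') (hu : ∀ hp, neg' (u hp) = u hp)
    (v : X → A) (s t : Tree p X) (hst : ∀ w : X → TV, s.eval w = t.eval w) :
    ⟦s⟧[v] = ⟦t⟧[v] := by
  -- A root `x` makes both trees undefined whenever `x` is, so both may be split on `x ∨ ¬x` and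
  -- compared after restriction.
  have step : ∀ (x : X) (l r t : Tree p X),
      (∀ w : X → TV, (node x l r).eval w = t.eval w) →
      (∀ b, ⟦(node x l r).restrict x b⟧[v] = ⟦t.restrict x b⟧[v]) →
      ⟦node x l r⟧[v] = ⟦t⟧[v] := by
    intro x l r t hst hb
    have hs := or_neg_and_interp (e := e) h hu v x (node x l r) fun w hw =>
      eval_eq_undef_of_node hw l r
    have ht := or_neg_and_interp (e := e) h hu v x t fun w hw => by
      rw [← hst w, eval_eq_undef_of_node hw]
    rw [← hs, ← ht, h.or_neg_and, h.or_neg_and, ← and_interp_restrict_true h,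
      ← and_interp_restrict_false h, hb, hb, and_interp_restrict_true h,
      and_interp_restrict_false h]
  induction hn : s.size + t.size using Nat.strong_induction_on generalizing s t with
  | _ n ih =>
  have hres (x : X) (b : Bool) (w : X → TV) :
      (s.restrict x b).eval w = (t.restrict x b).eval w := by
    rw [eval_restrict, eval_restrict, hst]
  -- Restricting at the root variable of one tree shrinks it strictly and does not enlarge the
  -- other.
  match s, t with
  | node x l r, t =>
    refine step x l r t hst fun b => ih _ ?_ _ _ (hres x b) rfl
    have := size_restrict_lt x b l r
    have := size_restrict_le x b t
    omega
  | s, node x l r =>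
    refine (step x l r s (fun w => (hst w).symm) fun b => (ih _ ?_ _ _ (hres x b) rfl).symm).symm
    have := size_restrict_lt x b l r
    have := size_restrict_le x b s
    omega
  | leaf true, leaf true => rfl
  | leaf false, leaf false => rfl
  | undef _, undef _ => rfl
  | leaf true, leaf false => cases hst fun _ => TV.U
  | leaf false, leaf true => cases hst fun _ => TV.U
  | leaf true, undef _ => cases hst fun _ => TV.U
  | leaf false, undef _ => cases hst fun _ => TV.U
  | undef _, leaf true => cases hst fun _ => TV.U
  | undef _, leaf false => cases hst fun _ => TV.U

end Interp

end Tree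

/-! ### Valid equations in algebras with a left unit of conjunction. -/

namespace Term

variable {S : Set TV} {X : Type u}

/-- The decision tree of a constant. -/
def constTree : S → Tree (TV.U ∈ S) X
  | ⟨TV.T, _⟩ => .leaf true
  | ⟨TV.F, _⟩ => .leaf false
  | ⟨TV.U, h⟩ => .undef h

/-- The decision tree of a term. -/
def toTree : Term S X → Tree (TV.U ∈ S) X
  | var x => .node x (.leaf true) (.leaf false)
  | const c => constTree c
  | neg t => t.toTree.neg
  | and s t => s.toTree.and t.toTree
  | or s t => (s.toTree.neg.and t.toTree.neg).neg

theorem eval_toTree (v : X → TV) (t : Term S X) : t.toTree.eval v = t.eval v := by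
  induction t with
  | var x => simp only [toTree, Tree.eval, eval]; cases v x <;> rfl
  | const c => obtain ⟨_ | _ | _, _⟩ := c <;> rfl
  | neg t ht => simp only [toTree, Tree.eval_neg, eval, ht]
  | and s t hs ht => simp only [toTree, Tree.eval_and, eval, hs, ht]
  | or s t hs ht =>
    simp only [toTree, Tree.eval_and, Tree.eval_neg, eval, hs, ht]
    cases s.eval v <;> cases t.eval v <;> rfl

variable {A : Type*} {M : Alg S A}

theorem interp_toTree (h : IsCond M.neg M.and M.or) {e : A} (he : ∀ x, M.and e x = x)
    (hT : ∀ hT, M.const ⟨TV.T, hT⟩ = e) (hF : ∀ hF, M.const ⟨TV.F, hF⟩ = M.neg e)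
    (hU : ∀ hU, M.neg (M.const ⟨TV.U, hU⟩) = M.const ⟨TV.U, hU⟩) (v : X → A) (t : Term S X) :
    t.toTree.interp M.neg M.and M.or e (fun hU => M.const ⟨TV.U, hU⟩) v = t.interp M v := by
  induction t with
  | var x => exact h.cond_one_zero he (v x)
  | const c =>
    obtain ⟨_ | _ | _, hc⟩ := c
    · exact (hT hc).symm
    · exact (hF hc).symm
    · rfl
  | neg t ht => simp only [toTree, Tree.interp_neg h hU, ht, interp]
  | and s t hs ht => simp only [toTree, Tree.interp_and h he hU, interp, hs, ht]
  | or s t hs ht =>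
    simp only [toTree, Tree.interp_and h he hU, Tree.interp_neg h hU, interp, hs, ht,
      h.neg_and, h.neg_neg]

/-- Valid equations hold in the algebras in which `e` is a left unit of conjunction. -/
theorem interp_eq_of_valid_of_one (h : IsCond M.neg M.and M.or) {e : A}
    (he : ∀ x, M.and e x = x) (hT : ∀ hT, M.const ⟨TV.T, hT⟩ = e)
    (hF : ∀ hF, M.const ⟨TV.F, hF⟩ = M.neg e)
    (hU : ∀ hU, M.neg (M.const ⟨TV.U, hU⟩) = M.const ⟨TV.U, hU⟩) {s t : Term S X}
    (hst : Valid s t) (v : X → A) : s.interp M v = t.interp M v := by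
  classical
  rw [← interp_toTree h he hT hF hU, ← interp_toTree h he hT hF hU]
  exact Tree.interp_eq_of_eval_eq h hU v _ _ fun w => by rw [eval_toTree, eval_toTree, hst w]

end Term

/-! ### Relativisation to a test, and models without a unit. -/

namespace Alg

variable {S : Set TV} {A : Type*}

/-- `M` satisfies the equation `q`. -/
def Sat (M : Alg S A) (q : Equation S) : Prop :=
  ∀ v : ℕ → A, q.lhs.interp M v = q.rhs.interp M v

/-- `M` satisfies the axioms of Guzmán and Squier. -/
structure IsCondModel (M : Alg S A) : Prop where
  isCond : IsCond M.neg M.and M.or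
  true_and : ∀ hT x, M.and (M.const ⟨TV.T, hT⟩) x = x
  neg_true : ∀ hT hF, M.neg (M.const ⟨TV.T, hT⟩) = M.const ⟨TV.F, hF⟩
  neg_undef : ∀ hU, M.neg (M.const ⟨TV.U, hU⟩) = M.const ⟨TV.U, hU⟩

/-- The subalgebra of the elements `x` with `e ∧ x = x`, with `e ∧ c` for each constant `c`. -/
def relativise (M : Alg S A) (h : IsCond M.neg M.and M.or) (e : A) (he : ∀ x, M.or e x = e) :
    Alg S {x // M.and e x = x} where
  neg x := ⟨M.neg x, by
    conv_rhs => rw [← x.2, h.neg_and, h.neg_or_of_or he]⟩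
  and x y := ⟨M.and x y, by rw [← h.assoc, x.2]⟩
  or x y := ⟨M.or x y, by rw [h.distrib, x.2, y.2]⟩
  const c := ⟨M.and e (M.const c), h.and_and_self_left _ _⟩

theorem relativise_isCond (M : Alg S A) (h : IsCond M.neg M.and M.or) (e : A)
    (he : ∀ x, M.or e x = e) :
    IsCond (M.relativise h e he).neg (M.relativise h e he).and (M.relativise h e he).or where
  neg_neg _ := Subtype.ext (h.neg_neg _)
  neg_and _ _ := Subtype.ext (h.neg_and _ _)
  assoc _ _ _ := Subtype.ext (h.assoc _ _ _)
  distrib _ _ _ := Subtype.ext (h.distrib _ _ _)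
  cond _ _ _ := Subtype.ext (h.cond _ _ _)
  absorb _ _ := Subtype.ext (h.absorb _ _)
  com _ _ := Subtype.ext (h.com _ _)

theorem neg_and_of_or {M : Alg S A} (h : IsCond M.neg M.and M.or) {e : A}
    (he : ∀ x, M.or e x = e) (x : A) : M.neg (M.and e x) = M.and e (M.neg x) := by
  rw [h.neg_and, h.neg_or_of_or he]

/-- The map `x ↦ e ∧ x` is a homomorphism onto the relativised algebra, because `e` passes through
all three connectives. -/
theorem interp_relativise (M : Alg S A) (h : IsCond M.neg M.and M.or) (e : A)
    (he : ∀ x, M.or e x = e) {X : Type*} (v : X → A) (t : Term S X) :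
    (t.interp (M.relativise h e he) fun x => ⟨M.and e (v x), h.and_and_self_left _ _⟩).1 =
      M.and e (t.interp M v) := by
  induction t with
  | var => rfl
  | const => rfl
  | neg t ht =>
    change M.neg _ = M.and e (M.neg _)
    rw [ht, neg_and_of_or h he]
  | and s t hs ht =>
    change M.and _ _ = M.and e (M.and _ _)
    rw [hs, ht, h.assoc, h.and_and_self_and]
  | or s t hs ht =>
    change M.or _ _ = M.and e (M.or _ _)
    rw [hs, ht, h.distrib]

end Alg

namespace Term

variable {S : Set TV} {X : Type u} {A : Type*} {M : Alg S A}

/-- In the relativised algebra `e` is a left unit and names `T`, so the result for algebras with a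
unit applies. The hypothesis `hS` is what pins `F` down, as the negation of `T`. -/
theorem and_interp_eq_of_valid (hS : TV.F ∈ S → TV.T ∈ S) (hM : M.IsCondModel) {e : A}
    (he : ∀ x, M.or e x = e) {s t : Term S X} (hst : Valid s t) (v : X → A) :
    M.and e (s.interp M v) = M.and e (t.interp M v) := by
  have h := hM.isCond
  rw [← M.interp_relativise h e he, ← M.interp_relativise h e he]
  have hT : ∀ hT, M.and e (M.const ⟨TV.T, hT⟩) = e := fun hT => h.and_one (hM.true_and hT) e
  congr 1
  refine interp_eq_of_valid_of_one (e := ⟨e, h.and_self e⟩) (M.relativise_isCond h e he)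
    (fun x => Subtype.ext x.2) (fun hT' => Subtype.ext (hT hT')) (fun hF => Subtype.ext ?_)
    (fun hU => Subtype.ext ?_) hst _
  · change M.and e (M.const ⟨TV.F, hF⟩) = M.neg e
    rw [← hM.neg_true (hS hF) hF, ← Alg.neg_and_of_or h he, hT]
  · change M.neg (M.and e (M.const ⟨TV.U, hU⟩)) = M.and e (M.const ⟨TV.U, hU⟩)
    rw [Alg.neg_and_of_or h he, hM.neg_undef]

/-- The value of the variable or constant that a term evaluates first. -/
def head (M : Alg S A) (v : X → A) : Term S X → A
  | var x => v x
  | const c => M.const c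
  | neg t => t.head M v
  | and s _ => s.head M v
  | or s _ => s.head M v

/-- A term is undefined whenever its first atom is. For `∨`, rewriting `e ∧ ·` as `¬e ∨ ·` reduces
the claim to associativity. -/
theorem or_neg_head_and_interp (h : IsCond M.neg M.and M.or) (v : X → A) (t : Term S X) :
    M.and (M.or (t.head M v) (M.neg (t.head M v))) (t.interp M v) = t.interp M v := by
  have atom (x : A) : M.and (M.or x (M.neg x)) x = x := by
    rw [h.or_neg_and, h.and_self, ← h.dual.or_neg_comm, h.absorb]
  induction t with
  | var x => exact atom _
  | const c => exact atom _
  | neg t ht =>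
    simp only [interp, head]
    conv_lhs => rw [← ht, Alg.neg_and_of_or h (h.or_neg_or _), h.and_and_self_left]
    conv_rhs => rw [← ht, Alg.neg_and_of_or h (h.or_neg_or _)]
  | and s t hs ht =>
    simp only [interp, head]
    rw [← h.assoc, hs]
  | or s t hs ht =>
    simp only [interp, head]
    conv_rhs => rw [← hs, ← h.neg_or_of_or (h.or_neg_or _), h.dual.assoc,
      h.neg_or_of_or (h.or_neg_or _)]

/-- Valid equations hold in all models of the axioms. -/
theorem interp_eq_of_valid (hS : TV.F ∈ S → TV.T ∈ S) (hM : M.IsCondModel) {s t : Term S X}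
    (hst : Valid s t) (v : X → A) : s.interp M v = t.interp M v := by
  have h := hM.isCond
  have hs := or_neg_head_and_interp h v s
  have ht := or_neg_head_and_interp h v t
  have h₁ := and_interp_eq_of_valid hS hM (h.or_neg_or (s.head M v)) hst v
  have h₂ := and_interp_eq_of_valid hS hM (h.or_neg_or (t.head M v)) hst v
  rw [hs] at h₁
  rw [ht] at h₂
  -- With head tests `d` of `s` and `e` of `t`: `s = d ∧ t = d ∧ e ∧ t = e ∧ d ∧ t = e ∧ s = t`.
  rw [h₁, ← ht, ← h.assoc, h.or_neg_and_comm, h.assoc, ← h₁, h₂, ht]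

theorem interp_subst (σ : ℕ → Term S X) (v : X → A) (t : Term S ℕ) :
    (t.subst σ).interp M v = t.interp M fun i => (σ i).interp M v := by
  induction t with
  | var => rfl
  | const => rfl
  | neg t ht => simp only [subst, interp, ht]
  | and s t hs ht => simp only [subst, interp, hs, ht]
  | or s t hs ht => simp only [subst, interp, hs, ht]

end Term

/-- The algebra `C`. -/
def standard (S : Set TV) : Alg S TV := ⟨TV.neg, TV.and, TV.or, (↑)⟩

theorem Term.interp_standard {S : Set TV} {X : Type*} (v : X → TV) (t : Term S X) :
    t.interp (standard S) v = t.eval v := by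
  induction t with
  | var => rfl
  | const => rfl
  | neg t ht => simp only [interp, eval, ht]; rfl
  | and s t hs ht => simp only [interp, eval, hs, ht]; rfl
  | or s t hs ht => simp only [interp, eval, hs, ht]; rfl

/-! ### Derivability and the free algebra. -/

namespace Derivable

variable {S : Set TV} {E : Set (Equation S)} {X : Type u}

theorem interp_eq {A : Type*} {M : Alg S A} (hM : ∀ q ∈ E, M.Sat q) {s t : Term S X}
    (h : Derivable E s t) (v : X → A) : s.interp M v = t.interp M v := by
  induction h with
  | ax q hq σ => rw [Term.interp_subst, Term.interp_subst]; exact hM q hq _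
  | refl => rfl
  | symm _ ih => exact ih.symm
  | trans _ _ ih₁ ih₂ => exact ih₁.trans ih₂
  | neg _ ih => simp only [Term.interp, ih]
  | and _ _ ih₁ ih₂ => simp only [Term.interp, ih₁, ih₂]
  | or _ _ ih₁ ih₂ => simp only [Term.interp, ih₁, ih₂]

theorem valid (hE : ∀ q ∈ E, (standard S).Sat q) {s t : Term S X} (h : Derivable E s t) :
    Valid s t := fun v => by
  simpa only [Term.interp_standard] using h.interp_eq hE v

variable (E X) in
/-- Provable equality. -/
def setoid : Setoid (Term S X) := ⟨Derivable E, refl, symm, trans⟩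

variable (E X) in
/-- The free algebra of the equations `E` on `X`. -/
def freeAlg : Alg S (Quotient (setoid E X)) where
  neg := Quotient.map Term.neg fun _ _ => neg
  and := Quotient.map₂ Term.and fun _ _ h₁ _ _ h₂ => and h₁ h₂
  or := Quotient.map₂ Term.or fun _ _ h₁ _ _ h₂ => or h₁ h₂
  const c := Quotient.mk _ (.const c)

theorem interp_freeAlg {Y : Type} (σ : Y → Term S X) (t : Term S Y) :
    t.interp (freeAlg E X) (fun i => Quotient.mk _ (σ i)) = Quotient.mk _ (t.subst σ) := by
  induction t with
  | var => rfl
  | const => rfl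
  | neg t ht => simp only [Term.interp, ht]; rfl
  | and s t hs ht => simp only [Term.interp, hs, ht]; rfl
  | or s t hs ht => simp only [Term.interp, hs, ht]; rfl

theorem interp_freeAlg_var (t : Term S X) :
    t.interp (freeAlg E X) (fun x => Quotient.mk _ (.var x)) = Quotient.mk _ t := by
  induction t with
  | var => rfl
  | const => rfl
  | neg t ht => simp only [Term.interp, ht]; rfl
  | and s t hs ht => simp only [Term.interp, hs, ht]; rfl
  | or s t hs ht => simp only [Term.interp, hs, ht]; rfl

theorem freeAlg_sat (q : Equation S) (hq : q ∈ E) : (freeAlg E X).Sat q := by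
  intro v
  -- Choosing representatives turns the valuation into a substitution, hence the claim into an
  -- instance of the axiom.
  have hv : v = fun i => Quotient.mk _ (v i).out := funext fun i => (Quotient.out_eq _).symm
  rw [hv, interp_freeAlg, interp_freeAlg]
  exact Quotient.sound (ax q hq _)

/-- The free algebra is a model of `E`; a valid equation holds there at the generic valuation, which
means that it is derivable. -/
theorem iff_valid (hS : TV.F ∈ S → TV.T ∈ S) (hE : ∀ q ∈ E, (standard S).Sat q)
    (hmodel : ∀ {A : Type u} (M : Alg S A), (∀ q ∈ E, M.Sat q) → M.IsCondModel)
    (s t : Term S X) : Derivable E s t ↔ Valid s t := by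
  refine ⟨valid hE, fun h => ?_⟩
  have := Term.interp_eq_of_valid hS (hmodel (freeAlg E X) freeAlg_sat) h
    fun x => Quotient.mk _ (.var x)
  rw [interp_freeAlg_var, interp_freeAlg_var] at this
  exact Quotient.exact this

/-- An axiom that fails in a model of the other axioms is not derivable from them. -/
theorem not_of_model {A : Type*} (M : Alg S A) {q : Equation S} (hM : ∀ r ∈ E, r = q ∨ M.Sat r)
    (hq : ¬ M.Sat q) : ¬ Derivable (E \ {q}) q.lhs q.rhs := fun h =>
  hq fun v => h.interp_eq (fun r hr => (hM r hr.1).resolve_left hr.2) v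

end Derivable

/-! ### The axioms as identities in an algebra. -/

namespace Alg

variable {S : Set TV} {A : Type*} {M : Alg S A}

/-- The valuation of the variables of the axioms by `a`, `b`, `c`. -/
def val (a b c : A) : ℕ → A
  | 0 => a
  | 1 => b
  | _ => c

theorem sat_dnegAx : M.Sat dnegAx ↔ ∀ a, M.neg (M.neg a) = a :=
  ⟨fun h a => h (val a a a), fun h _ => h _⟩

theorem sat_deMorganAx :
    M.Sat deMorganAx ↔ ∀ a b, M.neg (M.and a b) = M.or (M.neg a) (M.neg b) :=
  ⟨fun h a b => h (val a b b), fun h _ => h _ _⟩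

theorem sat_assocAx : M.Sat assocAx ↔ ∀ a b c, M.and (M.and a b) c = M.and a (M.and b c) :=
  ⟨fun h a b c => h (val a b c), fun h _ => h _ _ _⟩

theorem sat_distribAx :
    M.Sat distribAx ↔ ∀ a b c, M.and a (M.or b c) = M.or (M.and a b) (M.and a c) :=
  ⟨fun h a b c => h (val a b c), fun h _ => h _ _ _⟩

theorem sat_condAx : M.Sat condAx ↔
    ∀ a b c, M.and (M.or a b) c = M.or (M.and a c) (M.and (M.neg a) (M.and b c)) :=
  ⟨fun h a b c => h (val a b c), fun h _ => h _ _ _⟩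

theorem sat_dualAbsAx : M.Sat dualAbsAx ↔ ∀ a b, M.or a (M.and a b) = a :=
  ⟨fun h a b => h (val a b b), fun h _ => h _ _⟩

theorem sat_comAx :
    M.Sat comAx ↔ ∀ a b, M.or (M.and a b) (M.and b a) = M.or (M.and b a) (M.and a b) :=
  ⟨fun h a b => h (val a b b), fun h _ => h _ _⟩

theorem sat_orAx : M.Sat orAx ↔ ∀ a b, M.or a b = M.neg (M.and (M.neg a) (M.neg b)) :=
  ⟨fun h a b => h (val a b b), fun h _ => h _ _⟩

theorem sat_absAx : M.Sat absAx ↔ ∀ a b, M.and a (M.or a b) = a :=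
  ⟨fun h a b => h (val a b b), fun h _ => h _ _⟩

theorem sat_memAx : M.Sat memAx ↔
    ∀ a b c, M.and (M.or a b) c = M.or (M.and (M.neg a) (M.and b c)) (M.and a c) :=
  ⟨fun h a b c => h (val a b c), fun h _ => h _ _ _⟩

theorem sat_undAx {hU : TV.U ∈ S} :
    M.Sat (undAx hU) ↔ M.neg (M.const ⟨TV.U, hU⟩) = M.const ⟨TV.U, hU⟩ :=
  ⟨fun h => h fun _ => M.const ⟨TV.U, hU⟩, fun h _ => h⟩

theorem sat_tandAx {hT : TV.T ∈ S} :
    M.Sat (tandAx hT) ↔ ∀ a, M.and (M.const ⟨TV.T, hT⟩) a = a :=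
  ⟨fun h a => h (val a a a), fun h _ => h _⟩

theorem sat_negTAx {hT : TV.T ∈ S} {hF : TV.F ∈ S} :
    M.Sat (negTAx hT hF) ↔ M.neg (M.const ⟨TV.T, hT⟩) = M.const ⟨TV.F, hF⟩ :=
  ⟨fun h => h fun _ => M.const ⟨TV.T, hT⟩, fun h _ => h⟩

theorem sat_negAx {hT : TV.T ∈ S} {hF : TV.F ∈ S} :
    M.Sat (negAx hT hF) ↔ M.const ⟨TV.F, hF⟩ = M.neg (M.const ⟨TV.T, hT⟩) :=
  ⟨fun h => h fun _ => M.const ⟨TV.T, hT⟩, fun h _ => h⟩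

theorem isMem_of_sat (h₁ : M.Sat dnegAx) (h₂ : M.Sat orAx) (h₃ : M.Sat absAx) (h₄ : M.Sat memAx)
    (h₅ : M.Sat comAx) : IsMem M.neg M.and M.or :=
  ⟨sat_dnegAx.1 h₁, sat_orAx.1 h₂, sat_absAx.1 h₃, sat_memAx.1 h₄, sat_comAx.1 h₅⟩

/-- Double negation follows from Or, Tand, Abs and Mem. -/
theorem sat_dnegAx_of_true {hT : TV.T ∈ S} (h₂ : M.Sat orAx) (h₃ : M.Sat (tandAx hT))
    (h₄ : M.Sat absAx) (h₅ : M.Sat memAx) : M.Sat dnegAx := by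
  rw [sat_orAx] at h₂
  rw [sat_tandAx] at h₃
  rw [sat_absAx] at h₄
  rw [sat_memAx] at h₅
  rw [sat_dnegAx]
  set T := M.const ⟨TV.T, hT⟩
  have one_or (a : A) : M.or T a = T := by rw [← h₃ (M.or T a), h₄]
  -- This is Mem with `x = y = T`.
  have expand (a : A) : M.or (M.and (M.neg T) a) a = a := by
    simpa only [one_or, h₃] using (h₅ T T a).symm
  have neg_zero (a : A) : M.neg (M.and (M.neg T) (M.neg a)) = T := by rw [← h₂, one_or]
  intro a
  -- By Or every disjunction is a negation, and `expand` makes `a` a disjunction. For `a = ¬b` the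
  -- first disjunct `¬T ∧ a` has negation `T`, so `expand a` reads `¬(T ∧ ¬a) = a`.
  obtain ⟨b, hb⟩ : ∃ b, a = M.neg b := ⟨_, ((h₂ _ _).symm.trans (expand a)).symm⟩
  have := expand a
  rwa [h₂, hb, neg_zero, h₃, ← hb] at this

end Alg

instance : Fintype TV := ⟨{TV.T, TV.F, TV.U}, by rintro (_ | _ | _) <;> simp⟩

/-! ### Soundness and completeness of the four systems. -/

section Completeness

theorem isMem_standard : IsMem TV.neg TV.and TV.or :=
  ⟨by decide, by decide, by decide, by decide, by decide⟩

theorem standard_sat_gsAxioms (S : Set TV) : ∀ q ∈ gsAxioms S, (standard S).Sat q := by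
  have h := isMem_standard.isCond
  rintro q (((rfl | rfl | rfl | rfl | rfl | rfl | rfl) | ⟨hU, rfl⟩) | ⟨hT, hF, rfl | rfl⟩)
  · exact Alg.sat_dnegAx.2 h.neg_neg
  · exact Alg.sat_deMorganAx.2 h.neg_and
  · exact Alg.sat_assocAx.2 h.assoc
  · exact Alg.sat_distribAx.2 h.distrib
  · exact Alg.sat_condAx.2 h.cond
  · exact Alg.sat_dualAbsAx.2 h.absorb
  · exact Alg.sat_comAx.2 h.com
  · exact fun _ => rfl
  · exact fun _ => rfl
  · exact fun _ => rfl

variable {S : Set TV}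

theorem isCondModel_of_gsAxioms (hS : TV.T ∈ S ↔ TV.F ∈ S) {A : Type*} (M : Alg S A)
    (h : ∀ q ∈ gsAxioms S, M.Sat q) : M.IsCondModel where
  isCond :=
    { neg_neg := Alg.sat_dnegAx.1 (h _ (by simp [gsAxioms]))
      neg_and := Alg.sat_deMorganAx.1 (h _ (by simp [gsAxioms]))
      assoc := Alg.sat_assocAx.1 (h _ (by simp [gsAxioms]))
      distrib := Alg.sat_distribAx.1 (h _ (by simp [gsAxioms]))
      cond := Alg.sat_condAx.1 (h _ (by simp [gsAxioms]))
      absorb := Alg.sat_dualAbsAx.1 (h _ (by simp [gsAxioms]))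
      com := Alg.sat_comAx.1 (h _ (by simp [gsAxioms])) }
  true_and hT := Alg.sat_tandAx.1 (h _ (.inr ⟨hT, hS.1 hT, .inl rfl⟩))
  neg_true hT hF := Alg.sat_negTAx.1 (h _ (.inr ⟨hT, hF, .inr rfl⟩))
  neg_undef hU := Alg.sat_undAx.1 (h _ (.inl (.inr ⟨hU, rfl⟩)))

theorem completelyAxiomatisesCL (hS : TV.T ∈ S ↔ TV.F ∈ S) {E : Set (Equation S)}
    (hE : ∀ q ∈ E, (standard S).Sat q)
    (hmodel : ∀ {A : Type u} (M : Alg S A), (∀ q ∈ E, M.Sat q) → M.IsCondModel) :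
    CompletelyAxiomatisesCL.{u} E := by
  intro X s t
  have h := Derivable.iff_valid hS.2 hE hmodel s t
  have h' := Derivable.iff_valid (E := gsAxioms S) hS.2 (standard_sat_gsAxioms S)
    (isCondModel_of_gsAxioms hS) s t
  exact ⟨h, h.trans h'.symm⟩

theorem standard_sat_orAx : (standard S).Sat orAx := Alg.sat_orAx.2 isMem_standard.or_eq

theorem standard_sat_absAx : (standard S).Sat absAx := Alg.sat_absAx.2 isMem_standard.absorb

theorem standard_sat_memAx : (standard S).Sat memAx := Alg.sat_memAx.2 isMem_standard.mem

theorem standard_sat_comAx : (standard S).Sat comAx := Alg.sat_comAx.2 isMem_standard.com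

theorem standard_sat_dnegAx : (standard S).Sat dnegAx := Alg.sat_dnegAx.2 isMem_standard.neg_neg

theorem completelyAxiomatisesCL_eqCLNone : CompletelyAxiomatisesCL.{u} eqCLNone := by
  refine completelyAxiomatisesCL (by simp) ?_ fun M h => ?_
  · rintro q (rfl | rfl | rfl | rfl | rfl)
    exacts [standard_sat_dnegAx, standard_sat_orAx, standard_sat_absAx, standard_sat_memAx,
      standard_sat_comAx]
  · simp only [eqCLNone, Set.mem_insert_iff, Set.mem_singleton_iff, forall_eq_or_imp,
      forall_eq] at h
    obtain ⟨hdneg, hor, habs, hmem, hcom⟩ := h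
    exact ⟨(Alg.isMem_of_sat hdneg hor habs hmem hcom).isCond, nofun, nofun, nofun⟩

theorem completelyAxiomatisesCL_eqCL : CompletelyAxiomatisesCL.{u} eqCL := by
  refine completelyAxiomatisesCL (by simp) ?_ fun M h => ?_
  · rintro q (rfl | rfl | rfl | rfl | rfl | rfl)
    exacts [fun _ => rfl, standard_sat_orAx, fun _ => rfl, standard_sat_absAx,
      standard_sat_memAx, standard_sat_comAx]
  · simp only [eqCL, Set.mem_insert_iff, Set.mem_singleton_iff, forall_eq_or_imp,
      forall_eq] at h
    obtain ⟨hneg, hor, htand, habs, hmem, hcom⟩ := h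
    have hdneg := Alg.sat_dnegAx_of_true hor htand habs hmem
    exact ⟨(Alg.isMem_of_sat hdneg hor habs hmem hcom).isCond, fun _ => Alg.sat_tandAx.1 htand,
      fun _ _ => (Alg.sat_negAx.1 hneg).symm, fun hU => by simp at hU⟩

theorem completelyAxiomatisesCL_eqCLOnlyU : CompletelyAxiomatisesCL.{u} eqCLOnlyU := by
  refine completelyAxiomatisesCL (by simp) ?_ fun M h => ?_
  · rintro q (rfl | rfl | rfl | rfl | rfl | rfl)
    exacts [standard_sat_dnegAx, fun _ => rfl, standard_sat_orAx, standard_sat_absAx,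
      standard_sat_memAx, standard_sat_comAx]
  · simp only [eqCLOnlyU, Set.mem_insert_iff, Set.mem_singleton_iff, forall_eq_or_imp,
      forall_eq] at h
    obtain ⟨hdneg, hund, hor, habs, hmem, hcom⟩ := h
    exact ⟨(Alg.isMem_of_sat hdneg hor habs hmem hcom).isCond, fun hT => by simp at hT,
      fun hT => by simp at hT, fun _ => Alg.sat_undAx.1 hund⟩

theorem completelyAxiomatisesCL_eqCLU : CompletelyAxiomatisesCL.{u} eqCLU := by
  refine completelyAxiomatisesCL (by simp) ?_ fun M h => ?_
  · rintro q (rfl | rfl | rfl | rfl | rfl | rfl | rfl)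
    exacts [fun _ => rfl, standard_sat_orAx, fun _ => rfl, standard_sat_absAx,
      standard_sat_memAx, standard_sat_comAx, fun _ => rfl]
  · simp only [eqCLU, Set.mem_insert_iff, Set.mem_singleton_iff, forall_eq_or_imp,
      forall_eq] at h
    obtain ⟨hneg, hor, htand, habs, hmem, hcom, hund⟩ := h
    have hdneg := Alg.sat_dnegAx_of_true hor htand habs hmem
    exact ⟨(Alg.isMem_of_sat hdneg hor habs hmem hcom).isCond, fun _ => Alg.sat_tandAx.1 htand,
      fun _ _ => (Alg.sat_negAx.1 hneg).symm, fun _ => Alg.sat_undAx.1 hund⟩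

end Completeness

/-! ### Independence by small countermodels. -/

section Independence

variable (S : Set TV)

/-- A model of all axioms but Or. -/
def orModel : Alg S (Fin 3) where
  neg := Fin.rev
  and a b := if b = 1 then a else b
  or a b := if a = b then a else 1
  const _ := 1

/-- A model of all axioms but Abs. -/
def absModel : Alg S Bool := ⟨id, or, or, fun _ => false⟩

/-- Kleene's strong three-valued logic, a model of all axioms but Mem. -/
def memModel : Alg S (Fin 3) where
  neg := Fin.rev
  and := min
  or := max
  const
    | ⟨TV.T, _⟩ => 2
    | ⟨TV.F, _⟩ => 0
    | ⟨TV.U, _⟩ => 1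

/-- Short-circuit logic with two undefined truth values, a model of all axioms but Com. -/
def comModel : Alg S (Fin 4) where
  neg := Equiv.swap 0 1
  and a b := if a = 1 then b else a
  or a b := if a = 0 then b else a
  const
    | ⟨TV.T, _⟩ => 1
    | ⟨TV.F, _⟩ => 0
    | ⟨TV.U, _⟩ => 2

/-- A model of all axioms but double negation and Tand. -/
def projModel : Alg S Bool := ⟨fun _ => false, fun a _ => a, fun _ _ => false, fun _ => false⟩

/-- The algebra `C` with the constants renamed by `k`. -/
def renamedModel (k : TV → TV) : Alg S TV := ⟨TV.neg, TV.and, TV.or, fun c => k c⟩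

theorem independent_eqCLNone : Independent eqCLNone := by
  rintro q (rfl | rfl | rfl | rfl | rfl)
  · refine Derivable.not_of_model (projModel _) ?_ (by rw [Alg.sat_dnegAx]; decide)
    rintro r (rfl | rfl | rfl | rfl | rfl) <;>
      first
      | exact .inl rfl
      | (right; simp only [Alg.sat_orAx, Alg.sat_absAx, Alg.sat_memAx, Alg.sat_comAx]; decide)
  · refine Derivable.not_of_model (orModel _) ?_ (by rw [Alg.sat_orAx]; decide)
    rintro r (rfl | rfl | rfl | rfl | rfl) <;>
      first
      | exact .inl rfl
      | (right; simp only [Alg.sat_dnegAx, Alg.sat_absAx, Alg.sat_memAx, Alg.sat_comAx]; decide)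
  · refine Derivable.not_of_model (absModel _) ?_ (by rw [Alg.sat_absAx]; decide)
    rintro r (rfl | rfl | rfl | rfl | rfl) <;>
      first
      | exact .inl rfl
      | (right; simp only [Alg.sat_dnegAx, Alg.sat_orAx, Alg.sat_memAx, Alg.sat_comAx]; decide)
  · refine Derivable.not_of_model (memModel _) ?_ (by rw [Alg.sat_memAx]; decide)
    rintro r (rfl | rfl | rfl | rfl | rfl) <;>
      first
      | exact .inl rfl
      | (right; simp only [Alg.sat_dnegAx, Alg.sat_orAx, Alg.sat_absAx, Alg.sat_comAx]; decide)
  · refine Derivable.not_of_model (comModel _) ?_ (by rw [Alg.sat_comAx]; decide)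
    rintro r (rfl | rfl | rfl | rfl | rfl) <;>
      first
      | exact .inl rfl
      | (right; simp only [Alg.sat_dnegAx, Alg.sat_orAx, Alg.sat_absAx, Alg.sat_memAx]; decide)

theorem independent_eqCL : Independent eqCL := by
  rintro q (rfl | rfl | rfl | rfl | rfl | rfl)
  -- The constant `F` occurs in no axiom but Neg, so it may denote the value `T`.
  · refine Derivable.not_of_model (renamedModel _ fun c => if c = TV.F then TV.T else c) ?_
      (by rw [Alg.sat_negAx]; decide)
    rintro r (rfl | rfl | rfl | rfl | rfl | rfl) <;>
      first
      | exact .inl rfl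
      | (right; simp only [Alg.sat_orAx, Alg.sat_tandAx, Alg.sat_absAx, Alg.sat_memAx,
          Alg.sat_comAx]; decide)
  · refine Derivable.not_of_model (orModel _) ?_ (by rw [Alg.sat_orAx]; decide)
    rintro r (rfl | rfl | rfl | rfl | rfl | rfl) <;>
      first
      | exact .inl rfl
      | (right; simp only [Alg.sat_negAx, Alg.sat_tandAx, Alg.sat_absAx, Alg.sat_memAx,
          Alg.sat_comAx]; decide)
  -- Double negation fails here as well, which is harmless because it is not an axiom of this
  -- system.
  · refine Derivable.not_of_model (projModel _) ?_ (by rw [Alg.sat_tandAx]; decide)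
    rintro r (rfl | rfl | rfl | rfl | rfl | rfl) <;>
      first
      | exact .inl rfl
      | (right; simp only [Alg.sat_negAx, Alg.sat_orAx, Alg.sat_absAx, Alg.sat_memAx,
          Alg.sat_comAx]; decide)
  · refine Derivable.not_of_model (absModel _) ?_ (by rw [Alg.sat_absAx]; decide)
    rintro r (rfl | rfl | rfl | rfl | rfl | rfl) <;>
      first
      | exact .inl rfl
      | (right; simp only [Alg.sat_negAx, Alg.sat_orAx, Alg.sat_tandAx, Alg.sat_memAx,
          Alg.sat_comAx]; decide)
  · refine Derivable.not_of_model (memModel _) ?_ (by rw [Alg.sat_memAx]; decide)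
    rintro r (rfl | rfl | rfl | rfl | rfl | rfl) <;>
      first
      | exact .inl rfl
      | (right; simp only [Alg.sat_negAx, Alg.sat_orAx, Alg.sat_tandAx, Alg.sat_absAx,
          Alg.sat_comAx]; decide)
  · refine Derivable.not_of_model (comModel _) ?_ (by rw [Alg.sat_comAx]; decide)
    rintro r (rfl | rfl | rfl | rfl | rfl | rfl) <;>
      first
      | exact .inl rfl
      | (right; simp only [Alg.sat_negAx, Alg.sat_orAx, Alg.sat_tandAx, Alg.sat_absAx,
          Alg.sat_memAx]; decide)

theorem independent_eqCLOnlyU : Independent eqCLOnlyU := by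
  rintro q (rfl | rfl | rfl | rfl | rfl | rfl)
  · refine Derivable.not_of_model (projModel _) ?_ (by rw [Alg.sat_dnegAx]; decide)
    rintro r (rfl | rfl | rfl | rfl | rfl | rfl) <;>
      first
      | exact .inl rfl
      | (right; simp only [Alg.sat_undAx, Alg.sat_orAx, Alg.sat_absAx, Alg.sat_memAx,
          Alg.sat_comAx]; decide)
  -- The constant `U` occurs only in Und, so it may denote `T`, which negation moves.
  · refine Derivable.not_of_model (renamedModel _ fun c => if c = TV.U then TV.T else c) ?_
      (by rw [Alg.sat_undAx]; decide)
    rintro r (rfl | rfl | rfl | rfl | rfl | rfl) <;>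
      first
      | exact .inl rfl
      | (right; simp only [Alg.sat_dnegAx, Alg.sat_orAx, Alg.sat_absAx, Alg.sat_memAx,
          Alg.sat_comAx]; decide)
  · refine Derivable.not_of_model (orModel _) ?_ (by rw [Alg.sat_orAx]; decide)
    rintro r (rfl | rfl | rfl | rfl | rfl | rfl) <;>
      first
      | exact .inl rfl
      | (right; simp only [Alg.sat_dnegAx, Alg.sat_undAx, Alg.sat_absAx, Alg.sat_memAx,
          Alg.sat_comAx]; decide)
  · refine Derivable.not_of_model (absModel _) ?_ (by rw [Alg.sat_absAx]; decide)
    rintro r (rfl | rfl | rfl | rfl | rfl | rfl) <;>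
      first
      | exact .inl rfl
      | (right; simp only [Alg.sat_dnegAx, Alg.sat_undAx, Alg.sat_orAx, Alg.sat_memAx,
          Alg.sat_comAx]; decide)
  · refine Derivable.not_of_model (memModel _) ?_ (by rw [Alg.sat_memAx]; decide)
    rintro r (rfl | rfl | rfl | rfl | rfl | rfl) <;>
      first
      | exact .inl rfl
      | (right; simp only [Alg.sat_dnegAx, Alg.sat_undAx, Alg.sat_orAx, Alg.sat_absAx,
          Alg.sat_comAx]; decide)
  · refine Derivable.not_of_model (comModel _) ?_ (by rw [Alg.sat_comAx]; decide)
    rintro r (rfl | rfl | rfl | rfl | rfl | rfl) <;>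
      first
      | exact .inl rfl
      | (right; simp only [Alg.sat_dnegAx, Alg.sat_undAx, Alg.sat_orAx, Alg.sat_absAx,
          Alg.sat_memAx]; decide)

theorem independent_eqCLU : Independent eqCLU := by
  rintro q (rfl | rfl | rfl | rfl | rfl | rfl | rfl)
  · refine Derivable.not_of_model (renamedModel _ fun c => if c = TV.F then TV.T else c) ?_
      (by rw [Alg.sat_negAx]; decide)
    rintro r (rfl | rfl | rfl | rfl | rfl | rfl | rfl) <;>
      first
      | exact .inl rfl
      | (right; simp only [Alg.sat_orAx, Alg.sat_tandAx, Alg.sat_absAx, Alg.sat_memAx,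
          Alg.sat_comAx, Alg.sat_undAx]; decide)
  · refine Derivable.not_of_model (orModel _) ?_ (by rw [Alg.sat_orAx]; decide)
    rintro r (rfl | rfl | rfl | rfl | rfl | rfl | rfl) <;>
      first
      | exact .inl rfl
      | (right; simp only [Alg.sat_negAx, Alg.sat_tandAx, Alg.sat_absAx, Alg.sat_memAx,
          Alg.sat_comAx, Alg.sat_undAx]; decide)
  · refine Derivable.not_of_model (projModel _) ?_ (by rw [Alg.sat_tandAx]; decide)
    rintro r (rfl | rfl | rfl | rfl | rfl | rfl | rfl) <;>
      first
      | exact .inl rfl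
      | (right; simp only [Alg.sat_negAx, Alg.sat_orAx, Alg.sat_absAx, Alg.sat_memAx,
          Alg.sat_comAx, Alg.sat_undAx]; decide)
  · refine Derivable.not_of_model (absModel _) ?_ (by rw [Alg.sat_absAx]; decide)
    rintro r (rfl | rfl | rfl | rfl | rfl | rfl | rfl) <;>
      first
      | exact .inl rfl
      | (right; simp only [Alg.sat_negAx, Alg.sat_orAx, Alg.sat_tandAx, Alg.sat_memAx,
          Alg.sat_comAx, Alg.sat_undAx]; decide)
  · refine Derivable.not_of_model (memModel _) ?_ (by rw [Alg.sat_memAx]; decide)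
    rintro r (rfl | rfl | rfl | rfl | rfl | rfl | rfl) <;>
      first
      | exact .inl rfl
      | (right; simp only [Alg.sat_negAx, Alg.sat_orAx, Alg.sat_tandAx, Alg.sat_absAx,
          Alg.sat_comAx, Alg.sat_undAx]; decide)
  · refine Derivable.not_of_model (comModel _) ?_ (by rw [Alg.sat_comAx]; decide)
    rintro r (rfl | rfl | rfl | rfl | rfl | rfl | rfl) <;>
      first
      | exact .inl rfl
      | (right; simp only [Alg.sat_negAx, Alg.sat_orAx, Alg.sat_tandAx, Alg.sat_absAx,
          Alg.sat_memAx, Alg.sat_undAx]; decide)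
  · refine Derivable.not_of_model (renamedModel _ fun c => if c = TV.U then TV.T else c) ?_
      (by rw [Alg.sat_undAx]; decide)
    rintro r (rfl | rfl | rfl | rfl | rfl | rfl | rfl) <;>
      first
      | exact .inl rfl
      | (right; simp only [Alg.sat_negAx, Alg.sat_orAx, Alg.sat_tandAx, Alg.sat_absAx,
          Alg.sat_memAx, Alg.sat_comAx]; decide)

end Independence

end CondLogic

theorem mainTheorem8 :
    (CondLogic.CompletelyAxiomatisesCL.{u} CondLogic.eqCLNone ∧
      CondLogic.Independent CondLogic.eqCLNone) ∧
    (CondLogic.CompletelyAxiomatisesCL.{u} CondLogic.eqCL ∧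
      CondLogic.Independent CondLogic.eqCL) ∧
    (CondLogic.CompletelyAxiomatisesCL.{u} CondLogic.eqCLOnlyU ∧
      CondLogic.Independent CondLogic.eqCLOnlyU) ∧
    (CondLogic.CompletelyAxiomatisesCL.{u} CondLogic.eqCLU ∧
      CondLogic.Independent CondLogic.eqCLU) :=
  ⟨⟨CondLogic.completelyAxiomatisesCL_eqCLNone, CondLogic.independent_eqCLNone⟩,
    ⟨CondLogic.completelyAxiomatisesCL_eqCL, CondLogic.independent_eqCL⟩,
    ⟨CondLogic.completelyAxiomatisesCL_eqCLOnlyU, CondLogic.independent_eqCLOnlyU⟩,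
    ⟨CondLogic.completelyAxiomatisesCL_eqCLU, CondLogic.independent_eqCLU⟩⟩
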